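/- **Proposition 4.2.** Let $M$ be a finite-dimensional smooth manifold (Hausdorff, second countable) with a symplectic form $\omega$ (a smooth, closed, nondegenerate real $2$-form), and let $\hbar>0$. *Conventions.* A Hermitian connection $\nabla$ on a Hermitian line bundle is said to have curvature the real $2$-form $\Omega$ if $\nabla_X\nabla_Y-\nabla_Y\nabla_X-\nabla_{[X,Y]}=-\sqrt{-1}\,\Omega(X,Y)$ for all vector fields $X,Y$; thus $\mathrm d-\sqrt{-1}\,\hbar^{-1}\theta$ has curvature $\hbar^{-1}\mathrm d\theta$. *Path space.* Let $\mathcal PM$ be the space of all smooth maps $\gamma:[0,1]\to M$, with the differentiable structure in which a map $\varphi:\mathbb R^n\to\mathcal PM$ ($n\ge 0$) is smooth (a plot) if and only if $(u,t)\mapsto\varphi(u)(t)$ is a smooth map $\mathbb R^n\times[0,1]\to M$. The tangent space $T_\gamma\mathcal PM$ is the space of smooth vector fields along $\gamma$, and the differential of a plot is $d\varphi_u(w)(t)=d(\mathrm{ev}_t\circ\varphi)_u(w)$, where $\mathrm{ev}_t(\gamma)=\gamma(t)$. Differential forms on $\mathcal PM$, and connections and their curvature on bundles over $\mathcal PM$,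 are understood through pull-back along plots: a Hermitian connection on a Hermitian line bundle over $\mathcal PM$ is a family of smooth Hermitian connections on its pull-backs along all plots $\varphi$, compatible with smooth changes of parameters $\mathbb R^k\to\mathbb R^n$, and it has curvature $\Omega$ if its pull-back along every plot $\varphi$ has curvature $\varphi^*\Omega$. For $v,w\in T_\gamma\mathcal PM$ put $$\widetilde\omega_\gamma(v,w)=\int_0^1\omega\bigl(v(t),w(t)\bigr)\,dt,\qquad \lambda_\gamma(v)=\int_0^1\Bigl(\int_0^t\omega\bigl(\dot\gamma(\tau),v(\tau)\bigr)\,d\tau\Bigr)dt .$$ *Statement.* Let $L\to M$ be a smooth complex line bundle with a Hermitian structure $H$ and a smooth Hermitian connection $\nabla$ whose curvature is $\hbar^{-1}\omega$. Then $$\widetilde\nabla=\mathrm{ev}_0^*\nabla-\sqrt{-1}\,\hbar^{-1}\lambda$$ is a Hermitian connection on the Hermitian line bundle $(\mathrm{ev}_0^*L,\mathrm{ev}_0^*H)$ over $\mathcal PM$, and its curvature is $\hbar^{-1}\widetilde\omega$. -/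

import Mathlib

open Bundle Diffeology
open scoped Manifold ContDiff Topology

noncomputable section

section Instances

instance continuousSMulReal (V : Type*) [AddCommGroup V] [Module ℂ V] [TopologicalSpace V]
    [ContinuousSMul ℂ V] : ContinuousSMul ℝ V :=
  IsScalarTower.continuousSMul ℂ

/-- A complex line bundle is in particular a real vector bundle. -/
instance vectorBundleReal {B : Type*} [TopologicalSpace B] (V : B → Type*)
    [TopologicalSpace (TotalSpace ℂ V)] [∀ x, AddCommGroup (V x)] [∀ x, Module ℂ (V x)]
    [∀ x, TopologicalSpace (V x)] [FiberBundle ℂ V] [VectorBundle ℂ ℂ V] :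
    VectorBundle ℝ ℂ V where
  trivialization_linear' e he := by
    have := (inferInstance : e.IsLinear ℂ)
    refine ⟨fun b hb ↦ ⟨(e.linear ℂ hb).map_add, fun c v ↦ ?_⟩⟩
    have := (e.linear ℂ hb).map_smul (c : ℂ) v
    simpa using this
  continuousOn_coordChange' e e' he he' := by
    have h := continuousOn_coordChange ℂ e e'
    have := (ContinuousLinearMap.restrictScalarsL ℂ ℂ ℂ ℝ ℝ).continuous.comp_continuousOn h
    refine this.congr fun b hb ↦ ?_
    refine ContinuousLinearMap.ext fun v ↦ ?_
    change _ = (e.coordChangeL ℂ e' b) v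
    rw [e.coordChangeL_apply e' hb]
    let _ : e.IsLinear ℝ := ⟨fun b hb ↦ ⟨(e.linear ℂ hb).map_add, fun c v ↦ by
      simpa using (e.linear ℂ hb).map_smul (c : ℂ) v⟩⟩
    let _ : e'.IsLinear ℝ := ⟨fun b hb ↦ ⟨(e'.linear ℂ hb).map_add, fun c v ↦ by
      simpa using (e'.linear ℂ hb).map_smul (c : ℂ) v⟩⟩
    exact e.coordChangeL_apply e' hb v

variable {B B' : Type*} (f : B' → B) (V : B → Type*)

instance pullbackAddCommGroup [∀ x, AddCommGroup (V x)] (x : B') : AddCommGroup ((f *ᵖ V) x) :=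
  inferInstanceAs (AddCommGroup (V (f x)))

instance pullbackIsTopologicalAddGroup [∀ x, AddCommGroup (V x)] [∀ x, TopologicalSpace (V x)]
    [∀ x, IsTopologicalAddGroup (V x)] (x : B') : IsTopologicalAddGroup ((f *ᵖ V) x) :=
  inferInstanceAs (IsTopologicalAddGroup (V (f x)))

instance pullbackContinuousSMul {𝕜 : Type*} [Semiring 𝕜] [TopologicalSpace 𝕜]
    [∀ x, AddCommGroup (V x)] [∀ x, Module 𝕜 (V x)] [∀ x, TopologicalSpace (V x)]
    [∀ x, ContinuousSMul 𝕜 (V x)] (x : B') : ContinuousSMul 𝕜 ((f *ᵖ V) x) :=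
  inferInstanceAs (ContinuousSMul 𝕜 (V (f x)))

end Instances

section Connections

variable {E : Type*} [NormedAddCommGroup E] [NormedSpace ℝ E]
  {K : Type*} [TopologicalSpace K] {I : ModelWithCorners ℝ E K}
  {B : Type*} [TopologicalSpace B] [ChartedSpace K B] [IsManifold I ∞ B]
  {V : B → Type*} [TopologicalSpace (TotalSpace ℂ V)]
  [∀ x, AddCommGroup (V x)] [∀ x, Module ℂ (V x)] [∀ x, TopologicalSpace (V x)]
  [∀ x, IsTopologicalAddGroup (V x)] [∀ x, ContinuousSMul ℂ (V x)]
  [FiberBundle ℂ V] [VectorBundle ℂ ℂ V]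

variable (I) in
/-- The section `σ` of a complex line bundle is smooth at `x`. -/
abbrev SmoothSectionAt (σ : Π x : B, V x) (x : B) : Prop :=
  ContMDiffAt I (I.prod 𝓘(ℝ, ℂ)) ∞ (fun y ↦ TotalSpace.mk' ℂ y (σ y)) x

variable (I) in
/-- The section `σ` of a complex line bundle is differentiable at `x`. -/
abbrev DifferentiableSectionAt (σ : Π x : B, V x) (x : B) : Prop :=
  MDifferentiableAt I (I.prod 𝓘(ℝ, ℂ)) (fun y ↦ TotalSpace.mk' ℂ y (σ y)) x

/-- The vector field `X` is smooth at `x`. -/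
abbrev SmoothFieldAt (X : Π x : B, TangentSpace I x) (x : B) : Prop :=
  ContMDiffAt I I.tangent ∞ (fun y ↦ (⟨y, X y⟩ : TangentBundle I B)) x

variable (I V) in
/-- The type of maps which assign to a section `σ` of `V` a map `x ↦ (v ↦ ∇_v σ)`. -/
abbrev ConnectionMap := (Π x : B, V x) → Π x : B, TangentSpace I x →L[ℝ] V x

variable (I V) in
/-- A Hermitian structure on the complex line bundle `V`: a smooth family of Hermitian inner
products on the fibres, conjugate-linear in the first variable. -/
structure HermitianMetric where
  inner : ∀ x : B, V x →ₗ⋆[ℂ] V x →ₗ[ℂ] ℂ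
  conj_symm : ∀ x (v w : V x), starRingEnd ℂ (inner x v w) = inner x w v
  pos : ∀ x (v : V x), v ≠ 0 → 0 < (inner x v v).re
  smooth : ∀ (σ τ : Π x : B, V x) (x : B), SmoothSectionAt I σ x → SmoothSectionAt I τ x →
    ContMDiffAt I 𝓘(ℝ, ℂ) ∞ (fun y ↦ inner y (σ y) (τ y)) x

/-- `cov` is a smooth Hermitian connection on the complex line bundle `V`; here `cov σ x v` is
`∇_v σ`. -/
structure IsHermitianConnection (H : HermitianMetric I V)
    (cov : ConnectionMap I V) : Prop where
  isCovariantDerivative : IsCovariantDerivativeOn ℂ cov Set.univ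
  smul_I : ∀ (σ : Π x : B, V x) (x : B), DifferentiableSectionAt I σ x →
    ∀ v : TangentSpace I x, cov (fun y ↦ Complex.I • σ y) x v = Complex.I • cov σ x v
  smooth : ContMDiffCovariantDerivativeOn ℂ ∞ cov Set.univ
  metric : ∀ (σ τ : Π x : B, V x) (x : B), DifferentiableSectionAt I σ x →
    DifferentiableSectionAt I τ x → ∀ v : TangentSpace I x,
    mvfderiv I (fun y ↦ H.inner y (σ y) (τ y)) x v =
      H.inner x (cov σ x v) (τ x) + H.inner x (σ x) (cov τ x v)

/-- The connection `cov` has curvature the real 2-form `Ω`, in the normalization of geometric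
quantization: `∇_X ∇_Y σ - ∇_Y ∇_X σ - ∇_[X,Y] σ = -√-1 Ω(X, Y) σ`, so that
`d - √-1 θ` has curvature `dθ`. -/
def HasCurvature (cov : ConnectionMap I V)
    (Ω : ∀ x : B, TangentSpace I x → TangentSpace I x → ℝ) : Prop :=
  ∀ (X Y : Π x : B, TangentSpace I x) (σ : Π x : B, V x) (x : B),
    SmoothFieldAt X x → SmoothFieldAt Y x → SmoothSectionAt I σ x →
    cov (fun y ↦ cov σ y (Y y)) x (X x) - cov (fun y ↦ cov σ y (X y)) x (Y x)
      - cov σ x (VectorField.mlieBracket I X Y x) = -(Complex.I * (Ω x (X x) (Y x) : ℂ)) • σ x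

variable {E' : Type*} [NormedAddCommGroup E'] [NormedSpace ℝ E']
  {K' : Type*} [TopologicalSpace K'] {I' : ModelWithCorners ℝ E' K'}
  {N : Type*} [TopologicalSpace N] [ChartedSpace K' N] [IsManifold I' ∞ N]

/-- The connection `∇ + c α` obtained by adding a complex multiple of a real 1-form `α`. -/
def addOneForm (cov : ConnectionMap I V) (c : ℂ) (α : Π x : B, TangentSpace I x →L[ℝ] ℝ) :
    ConnectionMap I V :=
  fun σ x ↦ cov σ x + (α x).smulRight (c • σ x)

/-- The pull-back `f^*∇` of a connection `∇` on `V → B` to the line bundle `f^*V → N`: if `s` is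
the local frame of `V` given by the preferred trivialization around `f u`, and
`σ = g • (s ∘ f)` near `u`, then `(f^*∇)_w σ = dg(w) s(f u) + g(u) ∇_{df(w)} s`. -/
def pullbackConnection (cov : ConnectionMap I V)
    (f : C^∞⟮I', N; I, B⟯) : ConnectionMap I' (f *ᵖ V) := fun σ u ↦
  let e := trivializationAt ℂ V (f u)
  let s : Π x : B, V x := fun x ↦ e.symm x 1
  let g : N → ℂ := fun y ↦ (e ⟨f y, σ y⟩).2
  (mvfderiv I' g u).smulRight (s (f u)) + g u • (cov s (f u) ∘L mfderiv I' I f u)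

set_option linter.unusedSectionVars false in
theorem HermitianMetric.smooth_pullback (H : HermitianMetric I V) (f : C^∞⟮I', N; I, B⟯)
    (σ τ : Π u : N, (f *ᵖ V) u) (u : N)
    (hσ : SmoothSectionAt I' σ u) (hτ : SmoothSectionAt I' τ u) :
    ContMDiffAt I' 𝓘(ℝ, ℂ) ∞ (fun y ↦ H.inner (f y) (σ y) (τ y)) u := by
  set e := trivializationAt ℂ V (f u)
  have he : f u ∈ e.baseSet := mem_baseSet_trivializationAt ℂ V (f u)
  set s : Π x : B, V x := fun x ↦ e.symm x 1
  have hs : SmoothSectionAt I s (f u) := by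
    refine (contMDiffAt_section (E := V) (f u)).2 ?_
    refine (contMDiffAt_const (c := (1 : ℂ))).congr_of_eventuallyEq ?_
    filter_upwards [e.open_baseSet.mem_nhds he] with y hy
    exact congrArg Prod.snd (e.apply_mk_symm hy 1)
  have coord (σ : Π u : N, (f *ᵖ V) u) (hσ : SmoothSectionAt I' σ u) :
      ContMDiffAt I' 𝓘(ℝ, ℂ) ∞ (fun y ↦ (e ⟨f y, σ y⟩).2) u :=
    (contMDiffAt_section (E := f *ᵖ V) u).1 hσ
  have hh := (H.smooth s s (f u) hs hs).comp u f.contMDiff.contMDiffAt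
  have hconj := ((Complex.conjCLE : ℂ →L[ℝ] ℂ).contMDiff.contMDiffAt).comp u (coord σ hσ)
  have hmul {a b : N → ℂ} (ha : ContMDiffAt I' 𝓘(ℝ, ℂ) ∞ a u)
      (hb : ContMDiffAt I' 𝓘(ℝ, ℂ) ∞ b u) : ContMDiffAt I' 𝓘(ℝ, ℂ) ∞ (fun y ↦ a y * b y) u :=
    ((contDiff_mul (𝕜 := ℝ) (𝔸 := ℂ)).contMDiff.contMDiffAt).comp u (ha.prodMk_space hb)
  refine (hmul (hmul hconj (coord τ hτ)) hh).congr_of_eventuallyEq ?_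
  filter_upwards [f.contMDiff.continuous.continuousAt.preimage_mem_nhds
    (e.open_baseSet.mem_nhds he)] with y hy
  have key (v : V (f y)) : v = (e ⟨f y, v⟩).2 • s (f y) := by
    have h1 := e.symm_apply_apply_mk hy v
    have h2 := (e.symmₗ ℂ (f y)).map_smul (e ⟨f y, v⟩).2 (1 : ℂ)
    rw [smul_eq_mul, mul_one, e.coe_symmₗ (R := ℂ) hy] at h2
    exact h1.symm.trans h2
  calc H.inner (f y) (σ y) (τ y)
      = H.inner (f y) ((e ⟨f y, σ y⟩).2 • s (f y)) ((e ⟨f y, τ y⟩).2 • s (f y)) := by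
        exact congrArg₂ (fun a b ↦ H.inner (f y) a b) (key (σ y)) (key (τ y))
    _ = _ := by
        simp only [map_smulₛₗ, LinearMap.smul_apply, smul_eq_mul]
        simp only [RingHom.id_apply, Function.comp_apply, ContinuousLinearEquiv.coe_coe,
          Complex.conjCLE_apply]
        ring

/-- The pull-back `f^*H` of a Hermitian structure. -/
def HermitianMetric.pullback (H : HermitianMetric I V) (f : C^∞⟮I', N; I, B⟯) :
    HermitianMetric I' (f *ᵖ V) where
  inner u := H.inner (f u)
  conj_symm u := H.conj_symm (f u)
  pos u := H.pos (f u)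
  smooth := H.smooth_pullback f

end Connections

section PathSpace

variable (m : ℕ) (M : Type*) [TopologicalSpace M] [ChartedSpace (EuclideanSpace ℝ (Fin m)) M]
  [IsManifold (𝓡 m) ∞ M]

/-- A symplectic form on `M`: a smooth, alternating, closed and nondegenerate 2-form. -/
structure SymplecticForm where
  form : ∀ x : M, TangentSpace (𝓡 m) x →L[ℝ] TangentSpace (𝓡 m) x →L[ℝ] ℝ
  smooth : ContMDiff (𝓡 m) ((𝓡 m).prod
      𝓘(ℝ, EuclideanSpace ℝ (Fin m) →L[ℝ] EuclideanSpace ℝ (Fin m) →L[ℝ] ℝ)) ∞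
    (fun x ↦ TotalSpace.mk'
      (EuclideanSpace ℝ (Fin m) →L[ℝ] EuclideanSpace ℝ (Fin m) →L[ℝ] ℝ) x (form x))
  alternating : ∀ x v, form x v v = 0
  closed : ∀ (X Y Z : Π x : M, TangentSpace (𝓡 m) x) (x : M),
    SmoothFieldAt X x → SmoothFieldAt Y x → SmoothFieldAt Z x →
    mvfderiv (𝓡 m) (fun y ↦ form y (Y y) (Z y)) x (X x)
      + mvfderiv (𝓡 m) (fun y ↦ form y (Z y) (X y)) x (Y x)
      + mvfderiv (𝓡 m) (fun y ↦ form y (X y) (Y y)) x (Z x)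
      - form x (VectorField.mlieBracket (𝓡 m) X Y x) (Z x)
      - form x (VectorField.mlieBracket (𝓡 m) Y Z x) (X x)
      - form x (VectorField.mlieBracket (𝓡 m) Z X x) (Y x) = 0
  nondegenerate : ∀ x v, (∀ w, form x v w = 0) → v = 0

/-- The path space `𝒫M` of all smooth maps `[0, 1] → M`. -/
abbrev PathSpace := C^∞⟮𝓡∂ 1, unitInterval; 𝓡 m, M⟯

/-- The differentiable structure of the path space: a map `φ : ℝⁿ → 𝒫M` is smooth (a plot) iff
`(u, t) ↦ φ(u)(t)` is a smooth map `ℝⁿ × [0, 1] → M`. -/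
instance PathSpace.diffeology : DiffeologicalSpace (PathSpace m M) := .ofCorePlotsOn {
  isPlotOn := fun {n u} _ φ ↦ ContMDiffOn ((𝓡 n).prod (𝓡∂ 1)) (𝓡 m) ∞
    (fun p : EuclideanSpace ℝ (Fin n) × unitInterval ↦ φ p.1 p.2) (u ×ˢ Set.univ)
  isPlotOn_congr := fun {n u} _ p q h ↦
    contMDiffOn_congr fun z hz ↦ by rw [h hz.1]
  isPlot := fun {n} φ ↦ ContMDiff ((𝓡 n).prod (𝓡∂ 1)) (𝓡 m) ∞
    (fun p : EuclideanSpace ℝ (Fin n) × unitInterval ↦ φ p.1 p.2)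
  isPlotOn_univ := by simp [contMDiffOn_univ]
  isPlot_const := fun γ ↦ γ.contMDiff.comp contMDiff_snd
  isPlotOn_reparam := fun {n k u v} _ _ p f h hp hf ↦ by
    refine hp.comp (t := u ×ˢ Set.univ) (f := Prod.map f id) ?_ (fun z hz ↦ ⟨h hz.1, hz.2⟩)
    exact hf.contMDiffOn.prodMap contMDiffOn_id
  locality := fun {n u} _ p h z hz ↦ by
    obtain ⟨v, hv, hzv, hp⟩ := h z.1 hz.1
    exact ((hp z ⟨hzv, hz.2⟩).contMDiffAt
      ((hv.prod isOpen_univ).mem_nhds ⟨hzv, hz.2⟩)).contMDiffWithinAt }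

variable {m M}

/-- The tangent space `T_γ 𝒫M`: the vector space of smooth vector fields along `γ`, that is, of
smooth sections of `γ^*TM → [0, 1]`. -/
abbrev PathTangent (γ : PathSpace m M) :=
  Cₛ^∞⟮𝓡∂ 1; EuclideanSpace ℝ (Fin m), γ *ᵖ (TangentSpace (𝓡 m) : M → Type _)⟯

theorem contMDiff_alongPath_iff (γ : PathSpace m M) (v : Π t, TangentSpace (𝓡 m) (γ t)) :
    ContMDiff (𝓡∂ 1) ((𝓡∂ 1).prod 𝓘(ℝ, EuclideanSpace ℝ (Fin m))) ∞
      (fun t ↦ TotalSpace.mk' (EuclideanSpace ℝ (Fin m))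
        (E := γ *ᵖ (TangentSpace (𝓡 m) : M → Type _)) t (v t)) ↔
    ContMDiff (𝓡∂ 1) (𝓡 m).tangent ∞ (fun t ↦ (⟨γ t, v t⟩ : TangentBundle (𝓡 m) M)) := by
  refine forall_congr' fun t ↦ ?_
  refine (contMDiffAt_section (E := γ *ᵖ (TangentSpace (𝓡 m) : M → Type _)) t).trans
    (Iff.trans ?_ (contMDiffAt_totalSpace).symm)
  exact ⟨fun h ↦ ⟨γ.contMDiff t, h⟩, fun h ↦ h.2⟩

theorem contMDiff_unitField : ContMDiff (𝓡∂ 1) (𝓡∂ 1).tangent ∞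
    (fun t : unitInterval ↦ (⟨t, 1⟩ : TangentBundle (𝓡∂ 1) unitInterval)) := by
  have h1 := (contMDiffOn_projIcc (x := (0 : ℝ)) (y := 1) (n := ∞)).contMDiffOn_tangentMapWithin
    (m := ∞) le_rfl (uniqueDiffOn_Icc zero_lt_one).uniqueMDiffOn
  have h2 : ContMDiff (𝓡∂ 1) 𝓘(ℝ, ℝ).tangent ∞
      (fun t : unitInterval ↦ (⟨(t : ℝ), (1 : ℝ)⟩ : TangentBundle 𝓘(ℝ, ℝ) ℝ)) := by
    have h3 : ContMDiff 𝓘(ℝ, ℝ) 𝓘(ℝ, ℝ).tangent ∞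
        (fun t : ℝ ↦ (⟨t, (1 : ℝ)⟩ : TangentBundle 𝓘(ℝ, ℝ) ℝ)) := fun t ↦
      (contMDiffAt_vectorSpace_iff_contDiffAt (V := fun _ : ℝ ↦ (1 : ℝ))).2 contDiffAt_const
    exact h3.comp contMDiff_subtypeVal_Icc
  refine (h1.comp_contMDiff h2 fun t ↦ t.2).congr fun t ↦ ?_
  refine Bundle.TotalSpace.ext (Set.projIcc_val zero_le_one t).symm ?_
  change HEq (oneTangentSpaceIcc t) _
  rw [oneTangentSpaceIcc]
  rfl

/-- The velocity field `γ̇` of a path `γ`. -/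
def velocity (γ : PathSpace m M) : PathTangent γ where
  toFun t := mfderiv (𝓡∂ 1) (𝓡 m) γ t 1
  contMDiff_toFun := (contMDiff_alongPath_iff γ _).2 <|
    (γ.contMDiff.contMDiff_tangentMap (m := ∞) le_rfl).comp contMDiff_unitField

/-- The function `t ↦ ω(v(t), w(t))` on `[0, 1]`, for vector fields `v`, `w` along a path `γ`
(extended to the real line by its end values). -/
def SymplecticForm.along (symp : SymplecticForm m M) (γ : PathSpace m M) (v w : PathTangent γ)
    (t : ℝ) : ℝ :=
  let s : unitInterval := Set.projIcc 0 1 zero_le_one t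
  symp.form (γ s) (v s) (w s)

theorem SymplecticForm.continuous_along (symp : SymplecticForm m M) (γ : PathSpace m M)
    (v w : PathTangent γ) : Continuous (symp.along γ v w) := by
  have key : ContMDiff (𝓡∂ 1) ((𝓡 m).prod 𝓘(ℝ, ℝ)) ∞
      (fun t ↦ TotalSpace.mk' ℝ (E := Bundle.Trivial M ℝ) (γ t)
        (symp.form (γ t) (v t) (w t))) :=
    ContMDiff.clm_bundle_apply₂ (F₁ := EuclideanSpace ℝ (Fin m)) (F₂ := EuclideanSpace ℝ (Fin m))
      (symp.smooth.comp γ.contMDiff)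
      ((contMDiff_alongPath_iff γ _).1 v.contMDiff) ((contMDiff_alongPath_iff γ _).1 w.contMDiff)
  have h : Continuous fun t ↦ symp.form (γ t) (v t) (w t) :=
    continuous_iff_continuousAt.2 fun t ↦
      ((Bundle.contMDiffAt_totalSpace).1 (key t)).2.continuousAt
  exact h.comp continuous_projIcc

/-- The symplectic form of the path space: `ω̃(v, w)(γ) = ∫₀¹ ω(v(t), w(t)) dt`. -/
def pathSymplecticForm (symp : SymplecticForm m M) (γ : PathSpace m M) :
    PathTangent γ →ₗ[ℝ] PathTangent γ →ₗ[ℝ] ℝ :=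
  have hi (v w : PathTangent γ) : IntervalIntegrable (symp.along γ v w) MeasureTheory.volume 0 1 :=
    (symp.continuous_along γ v w).intervalIntegrable 0 1
  LinearMap.mk₂ ℝ (fun v w ↦ ∫ t in (0 : ℝ)..1, symp.along γ v w t)
    (fun v v' w ↦ by
      rw [← intervalIntegral.integral_add (hi v w) (hi v' w)]
      congr 1 with t
      exact DFunLike.congr_fun ((symp.form _).map_add _ _) _)
    (fun c v w ↦ by
      rw [← intervalIntegral.integral_smul]
      congr 1 with t
      exact DFunLike.congr_fun ((symp.form _).map_smul _ _) _)
    (fun v w w' ↦ by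
      rw [← intervalIntegral.integral_add (hi v w) (hi v w')]
      congr 1 with t
      exact (symp.form _ _).map_add _ _)
    (fun c v w ↦ by
      rw [← intervalIntegral.integral_smul]
      congr 1 with t
      exact (symp.form _ _).map_smul _ _)

/-- The 1-form `λ` on the path space:
`λ(v)(γ) = ∫₀¹ (∫₀ᵗ ω(γ̇(τ), v(τ)) dτ) dt`. -/
def chenOneForm (symp : SymplecticForm m M) (γ : PathSpace m M) : PathTangent γ →ₗ[ℝ] ℝ where
  toFun v := ∫ t in (0 : ℝ)..1, ∫ τ in (0 : ℝ)..t, symp.along γ (velocity γ) v τ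
  map_add' v w := by
    have hc (v : PathTangent γ) := symp.continuous_along γ (velocity γ) v
    have hi (v : PathTangent γ) (a b : ℝ) :=
      (hc v).intervalIntegrable (μ := MeasureTheory.volume) a b
    have hp (v : PathTangent γ) := (intervalIntegral.continuous_primitive (hi v) 0)
    rw [← intervalIntegral.integral_add ((hp v).intervalIntegrable 0 1)
      ((hp w).intervalIntegrable 0 1)]
    congr 1 with t
    rw [← intervalIntegral.integral_add (hi v 0 t) (hi w 0 t)]
    congr 1 with τ
    exact (symp.form _ _).map_add _ _
  map_smul' c v := by
    rw [RingHom.id_apply, ← intervalIntegral.integral_smul]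
    congr 1 with t
    rw [← intervalIntegral.integral_smul]
    congr 1 with τ
    exact (symp.form _ _).map_smul _ _

variable {n : ℕ}

/-- The smooth map `ev_t ∘ φ`, for a plot `φ` of the path space. -/
def plotEval (φ : EuclideanSpace ℝ (Fin n) → PathSpace m M) (hφ : IsPlot φ) (t : unitInterval) :
    C^∞⟮𝓡 n, EuclideanSpace ℝ (Fin n); 𝓡 m, M⟯ where
  val u := φ u t
  property := ContMDiff.comp (g := fun p : EuclideanSpace ℝ (Fin n) × unitInterval ↦ φ p.1 p.2)
    (f := fun u ↦ (u, t)) hφ (contMDiff_id.prodMk contMDiff_const)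

theorem contMDiff_plotDeriv (φ : EuclideanSpace ℝ (Fin n) → PathSpace m M) (hφ : IsPlot φ)
    (u : EuclideanSpace ℝ (Fin n)) (w : TangentSpace (𝓡 n) u) :
    ContMDiff (𝓡∂ 1) (𝓡 m).tangent ∞ (fun t ↦
      (⟨φ u t, mfderiv (𝓡 n) (𝓡 m) (plotEval φ hφ t) u w⟩ : TangentBundle (𝓡 m) M)) := by
  intro t
  have h1 : ContMDiff ((𝓡∂ 1).prod (𝓡 n)) (𝓡 m) ∞
      (Function.uncurry fun (t : unitInterval) (u : EuclideanSpace ℝ (Fin n)) ↦ φ u t) :=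
    ContMDiff.comp (g := fun p : EuclideanSpace ℝ (Fin n) × unitInterval ↦ φ p.1 p.2)
      (f := fun p : unitInterval × EuclideanSpace ℝ (Fin n) ↦ (p.2, p.1)) hφ
      (contMDiff_snd.prodMk contMDiff_fst)
  have h2 := ContMDiffAt.mfderiv (m := ∞) (x₀ := t)
    (fun (t : unitInterval) (u : EuclideanSpace ℝ (Fin n)) ↦ φ u t) (fun _ ↦ u)
    (h1.contMDiffAt) contMDiffAt_const le_rfl
  have h3 : ContMDiffAt (𝓡∂ 1) (𝓡 n).tangent ∞ (fun _ : unitInterval ↦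
      (⟨u, w⟩ : TangentBundle (𝓡 n) (EuclideanSpace ℝ (Fin n)))) t := contMDiffAt_const
  exact ContMDiffAt.clm_apply_of_inCoordinates (F₁ := EuclideanSpace ℝ (Fin n))
    (E₁ := (TangentSpace (𝓡 n) : EuclideanSpace ℝ (Fin n) → Type _))
    (b₁ := fun _ ↦ u) (b₂ := fun t ↦ φ u t) (v := fun _ ↦ w)
    h2 h3 ((φ u).contMDiff t)

/-- The differential `dφ_u : ℝⁿ → T_{φ(u)} 𝒫M` of a plot: `dφ_u(w)` is the vector field
`t ↦ d(ev_t ∘ φ)_u(w)` along the path `φ(u)`. -/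
def plotDeriv (φ : EuclideanSpace ℝ (Fin n) → PathSpace m M) (hφ : IsPlot φ)
    (u : EuclideanSpace ℝ (Fin n)) :
    TangentSpace (𝓡 n) u →ₗ[ℝ] PathTangent (φ u) where
  toFun w :=
    { toFun := fun t ↦ mfderiv (𝓡 n) (𝓡 m) (plotEval φ hφ t) u w
      contMDiff_toFun := (contMDiff_alongPath_iff (φ u) _).2 (contMDiff_plotDeriv φ hφ u w) }
  map_add' v w := ContMDiffSection.ext fun t ↦
    (mfderiv (𝓡 n) (𝓡 m) (plotEval φ hφ t) u).map_add v w
  map_smul' c w := ContMDiffSection.ext fun t ↦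
    (mfderiv (𝓡 n) (𝓡 m) (plotEval φ hφ t) u).map_smul c w

/-- The pull-back `φ^*α` to `ℝⁿ` of a 1-form `α` on the path space. -/
def plotPullback (α : ∀ γ : PathSpace m M, PathTangent γ →ₗ[ℝ] ℝ)
    (φ : EuclideanSpace ℝ (Fin n) → PathSpace m M) (hφ : IsPlot φ)
    (u : EuclideanSpace ℝ (Fin n)) : TangentSpace (𝓡 n) u →L[ℝ] ℝ :=
  let ℓ : EuclideanSpace ℝ (Fin n) →ₗ[ℝ] ℝ := α (φ u) ∘ₗ plotDeriv φ hφ u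
  (LinearMap.toContinuousLinearMap ℓ : EuclideanSpace ℝ (Fin n) →L[ℝ] ℝ)

section EvZero

variable (L : M → Type*) [TopologicalSpace (TotalSpace ℂ L)]
  [∀ x, AddCommGroup (L x)] [∀ x, Module ℂ (L x)] [∀ x, TopologicalSpace (L x)]
  [∀ x, IsTopologicalAddGroup (L x)] [∀ x, ContinuousSMul ℂ (L x)]
  [FiberBundle ℂ L] [VectorBundle ℂ ℂ L]

variable (m) in
/-- The data of a connection on `ev₀^*L → 𝒫M`: for every plot `φ : ℝⁿ → 𝒫M`, an operator
`σ ↦ ((u, w) ↦ ∇_w σ (u))` on sections of `φ^*ev₀^*L = (ev₀ ∘ φ)^*L → ℝⁿ`. -/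
abbrev EvZeroConnection :=
  ∀ ⦃n : ℕ⦄ (φ : EuclideanSpace ℝ (Fin n) → PathSpace m M) (hφ : IsPlot φ),
    ConnectionMap (𝓡 n) (plotEval φ hφ 0 *ᵖ L)

variable {L}

/-- The pull-back connection `ev₀^*∇` on `ev₀^*L`. -/
def evZeroPullback (cov : ConnectionMap (𝓡 m) L) :
    EvZeroConnection m L :=
  fun _ φ hφ ↦ pullbackConnection cov (plotEval φ hφ 0)

/-- The sum `∇ + c α` of a connection `∇` on `ev₀^*L` and a complex multiple of a real 1-form `α`
on the path space. -/
def EvZeroConnection.addOneForm (D : EvZeroConnection m L) (c : ℂ)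
    (α : ∀ γ : PathSpace m M, PathTangent γ →ₗ[ℝ] ℝ) : EvZeroConnection m L :=
  fun _ φ hφ ↦ _root_.addOneForm (D φ hφ) c (plotPullback α φ hφ)

/-- `D` is a Hermitian connection on the Hermitian line bundle `(ev₀^*L, ev₀^*H)`: on every plot
it is a smooth Hermitian connection, and these are compatible with changes of plots. -/
structure EvZeroConnection.IsHermitian (H : HermitianMetric (𝓡 m) L) (D : EvZeroConnection m L) :
    Prop where
  onPlot : ∀ (n : ℕ) (φ : EuclideanSpace ℝ (Fin n) → PathSpace m M) (hφ : IsPlot φ),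
    IsHermitianConnection (H.pullback (plotEval φ hφ 0)) (D φ hφ)
  natural : ∀ (n k : ℕ) (φ : EuclideanSpace ℝ (Fin n) → PathSpace m M) (hφ : IsPlot φ)
    (ψ : EuclideanSpace ℝ (Fin k) → EuclideanSpace ℝ (Fin n)) (hψ : ContDiff ℝ ∞ ψ)
    (σ : Π v, (plotEval φ hφ 0 *ᵖ L) v) (u w : EuclideanSpace ℝ (Fin k)),
    DifferentiableSectionAt (𝓡 n) σ (ψ u) →
    D (φ ∘ ψ) (isPlot_reparam hφ hψ) (fun v ↦ σ (ψ v)) u w = D φ hφ σ (ψ u) (fderiv ℝ ψ u w)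

/-- The connection `D` on `ev₀^*L` has curvature the 2-form `Ω` on the path space: for every plot
`φ`, the curvature of `φ^*D` is `φ^*Ω`. -/
def EvZeroConnection.HasCurvature (D : EvZeroConnection m L)
    (Ω : ∀ γ : PathSpace m M, PathTangent γ →ₗ[ℝ] PathTangent γ →ₗ[ℝ] ℝ) : Prop :=
  ∀ (n : ℕ) (φ : EuclideanSpace ℝ (Fin n) → PathSpace m M) (hφ : IsPlot φ),
    _root_.HasCurvature (D φ hφ)
      (fun u v w ↦ Ω (φ u) (plotDeriv φ hφ u v) (plotDeriv φ hφ u w))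

end EvZero

end PathSpace

end

set_option linter.unusedSectionVars false

/-! The identity behind the theorem is dλ = ω̃ - ev₀^*ω on the path space. The pulled back
connection ev₀^*∇ has curvature ħ⁻¹ ev₀^*ω, and adding -√-1 ħ⁻¹ λ changes the curvature by ħ⁻¹ dλ,
which replaces ev₀^*ω by ω̃. Since the added term is an imaginary multiple of a real 1-form, metric
compatibility is preserved.

To prove the identity along a plot φ, put Φ(u, t) = φ(u)(t) and Q = Φ^*ω, a closed 2-form on ℝⁿ ×
[0, 1]. Integrating by parts turns the double integral of λ into a weighted single one, (φ^*λ)(b) =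
∫₀¹ (1 - t) Q(∂_t, b) dt. Differentiating under the integral and using dQ = 0 for the constant
vectors a, b, ∂_t gives d(φ^*λ)(a, b) = ∫₀¹ (1 - t) ∂_t Q(a, b) dt. A second integration by parts
yields ∫₀¹ Q(a, b) dt - Q(a, b)|_{t=0}, that is, the pull-back of ω̃ - ev₀^*ω. This is
`fderiv_plotPullback_chenOneForm`; closedness of Q is `SymplecticForm.fderiv_pullback_cyclic`.

On the bundle side everything is read in a local frame s. If ∇s = A s, then f^*∇ + c α acts on g •
(s ∘ f) by dg + g β, where β = f^*A + c α (`IsHermitianConnection.addOneForm_pullback_eq`). Its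
curvature is therefore governed by dβ (`IsHermitianConnection.hasCurvature_addOneForm_pullback`),
and dA is the curvature of ∇ (`IsHermitianConnection.fderiv_pullback_connectionForm`). Exterior
derivatives on ℝⁿ are tested on constant vectors, where no bracket term occurs. -/

noncomputable section

/-! ### Local frames and connection forms of a complex line bundle -/

section Frame

variable {E : Type*} [NormedAddCommGroup E] [NormedSpace ℝ E]
  {K : Type*} [TopologicalSpace K] {I : ModelWithCorners ℝ E K}
  {B : Type*} [TopologicalSpace B] [ChartedSpace K B] [IsManifold I ∞ B]
  {V : B → Type*} [TopologicalSpace (TotalSpace ℂ V)]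
  [∀ x, AddCommGroup (V x)] [∀ x, Module ℂ (V x)] [∀ x, TopologicalSpace (V x)]
  [∀ x, IsTopologicalAddGroup (V x)] [∀ x, ContinuousSMul ℂ (V x)]
  [FiberBundle ℂ V] [VectorBundle ℂ ℂ V]

variable (V) in
/-- The frame of a complex line bundle given by the preferred trivialization at `x₀`. -/
def lineFrame (x₀ : B) : Π x : B, V x := fun x ↦ (trivializationAt ℂ V x₀).symm x 1

/-- The coordinate of a vector in the fibre over `x` with respect to `lineFrame V x₀`. -/
def lineCoord (x₀ : B) {x : B} (v : V x) : ℂ := (trivializationAt ℂ V x₀ ⟨x, v⟩).2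

variable (V) in
/-- The domain of `lineFrame V x₀`. -/
abbrev frameDomain (x₀ : B) : Set B := (trivializationAt ℂ V x₀).baseSet

theorem eq_lineCoord_smul {x₀ x : B} (hx : x ∈ frameDomain V x₀) (v : V x) :
    v = lineCoord x₀ v • lineFrame V x₀ x := by
  set e := trivializationAt ℂ V x₀
  have h1 := e.symm_apply_apply_mk hx v
  have h2 := (e.symmₗ ℂ x).map_smul (e ⟨x, v⟩).2 (1 : ℂ)
  rw [smul_eq_mul, mul_one, e.coe_symmₗ (R := ℂ) hx] at h2
  exact h1.symm.trans h2

theorem lineCoord_eq_clm {x₀ x : B} (hx : x ∈ frameDomain V x₀) (v : V x) :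
    lineCoord x₀ v = (trivializationAt ℂ V x₀).continuousLinearMapAt ℂ x v := by
  rw [Trivialization.continuousLinearMapAt_apply, Trivialization.coe_linearMapAt_of_mem _ hx]; rfl

theorem lineCoord_add {x₀ x : B} (hx : x ∈ frameDomain V x₀) (v w : V x) :
    lineCoord x₀ (v + w) = lineCoord x₀ v + lineCoord x₀ w := by
  simp [lineCoord_eq_clm hx]

theorem lineCoord_smul {x₀ x : B} (hx : x ∈ frameDomain V x₀) (c : ℂ) (v : V x) :
    lineCoord x₀ (c • v) = c * lineCoord x₀ v := by
  simp [lineCoord_eq_clm hx]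

theorem lineCoord_lineFrame {x₀ x : B} (hx : x ∈ frameDomain V x₀) :
    lineCoord x₀ (lineFrame V x₀ x) = 1 :=
  congrArg Prod.snd ((trivializationAt ℂ V x₀).apply_mk_symm hx 1)

theorem lineFrame_ne_zero {x₀ x : B} (hx : x ∈ frameDomain V x₀) : lineFrame V x₀ x ≠ 0 := by
  intro h
  have := lineCoord_lineFrame (V := V) hx
  rw [h, lineCoord_eq_clm hx, map_zero] at this
  exact zero_ne_one this

/-- The trivialization at `x₀` tests regularity at every point of its domain, so one fixed frame
serves on a whole neighbourhood of `x₀`. -/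
theorem differentiableSectionAt_iff [ContMDiffVectorBundle ∞ ℂ V I] {x₀ x : B}
    (hx : x ∈ frameDomain V x₀) (σ : Π x : B, V x) :
    DifferentiableSectionAt I σ x ↔
      MDifferentiableAt I 𝓘(ℝ, ℂ) (fun y ↦ lineCoord x₀ (σ y)) x :=
  (trivializationAt ℂ V x₀).mdifferentiableAt_section_iff I σ hx

theorem smoothSectionAt_iff [ContMDiffVectorBundle ∞ ℂ V I] {x₀ x : B}
    (hx : x ∈ frameDomain V x₀) (σ : Π x : B, V x) :
    SmoothSectionAt I σ x ↔
      ContMDiffAt I 𝓘(ℝ, ℂ) ∞ (fun y ↦ lineCoord x₀ (σ y)) x :=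
  (trivializationAt ℂ V x₀).contMDiffAt_section_iff hx

theorem smoothSectionAt_lineFrame [ContMDiffVectorBundle ∞ ℂ V I] {x₀ x : B}
    (hx : x ∈ frameDomain V x₀) : SmoothSectionAt I (lineFrame V x₀) x := by
  refine (smoothSectionAt_iff hx _).2 ((contMDiffAt_const (c := (1 : ℂ))).congr_of_eventuallyEq ?_)
  filter_upwards [(trivializationAt ℂ V x₀).open_baseSet.mem_nhds hx] with y hy
  exact lineCoord_lineFrame hy

theorem SmoothSectionAt.differentiableSectionAt {σ : Π x : B, V x} {x : B}
    (h : SmoothSectionAt I σ x) : DifferentiableSectionAt I σ x :=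
  h.mdifferentiableAt (by simp)

theorem DifferentiableSectionAt.smul [ContMDiffVectorBundle ∞ ℂ V I] {σ : Π x : B, V x}
    {g : B → ℂ} {x : B}
    (hg : MDifferentiableAt I 𝓘(ℝ, ℂ) g x) (hσ : DifferentiableSectionAt I σ x) :
    DifferentiableSectionAt I (fun y ↦ g y • σ y) x := by
  have hx : x ∈ frameDomain V x := mem_baseSet_trivializationAt ℂ V x
  rw [differentiableSectionAt_iff hx] at hσ ⊢
  refine (hg.mul hσ).congr_of_eventuallyEq ?_
  filter_upwards [(trivializationAt ℂ V x).open_baseSet.mem_nhds hx] with y hy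
  exact lineCoord_smul hy _ _

/-- The axioms give only the Leibniz rule for real functions and compatibility with multiplication
by √-1. Splitting g σ = (Re g) σ + (Im g)(√-1 σ) combines the two. -/
theorem IsHermitianConnection.leibniz_complex [ContMDiffVectorBundle ∞ ℂ V I]
    {H : HermitianMetric I V} {cov : ConnectionMap I V} (h : IsHermitianConnection H cov)
    {σ : Π x : B, V x} {g : B → ℂ} {x : B}
    (hg : MDifferentiableAt I 𝓘(ℝ, ℂ) g x) (hσ : DifferentiableSectionAt I σ x)
    (v : TangentSpace I x) :
    cov (fun y ↦ g y • σ y) x v = mvfderiv I g x v • σ x + g x • cov σ x v := by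
  have hre : MDifferentiableAt I 𝓘(ℝ, ℝ) (fun y ↦ (g y).re) x :=
    (Complex.reCLM.mdifferentiableAt (x := g x)).comp x hg
  have him : MDifferentiableAt I 𝓘(ℝ, ℝ) (fun y ↦ (g y).im) x :=
    (Complex.imCLM.mdifferentiableAt (x := g x)).comp x hg
  have hI : DifferentiableSectionAt I (fun y ↦ Complex.I • σ y) x :=
    DifferentiableSectionAt.smul mdifferentiableAt_const hσ
  have dre : mvfderiv I (fun y ↦ (g y).re) x v = (mvfderiv I g x v).re := by
    have := mfderiv_comp_apply x (Complex.reCLM.mdifferentiableAt (x := g x)) hg v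
    rw [Complex.reCLM.mfderiv_eq] at this
    exact this
  have dim : mvfderiv I (fun y ↦ (g y).im) x v = (mvfderiv I g x v).im := by
    have := mfderiv_comp_apply x (Complex.imCLM.mdifferentiableAt (x := g x)) hg v
    rw [Complex.imCLM.mfderiv_eq] at this
    exact this
  have key : (fun y ↦ g y • σ y) =
      (fun y ↦ (g y).re) • σ + (fun y ↦ (g y).im) • (fun y ↦ Complex.I • σ y) := by
    funext y
    change g y • σ y = ((g y).re : ℂ) • σ y + ((g y).im : ℂ) • Complex.I • σ y
    rw [smul_smul, ← add_smul, Complex.re_add_im]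
  have d1 : DifferentiableSectionAt I ((fun y ↦ (g y).re) • σ) x :=
    DifferentiableSectionAt.smul (g := fun y ↦ ((g y).re : ℂ))
      ((Complex.ofRealCLM.mdifferentiableAt (x := (g x).re)).comp x hre) hσ
  have d2 : DifferentiableSectionAt I ((fun y ↦ (g y).im) • (fun y ↦ Complex.I • σ y)) x :=
    DifferentiableSectionAt.smul (g := fun y ↦ ((g y).im : ℂ))
      ((Complex.ofRealCLM.mdifferentiableAt (x := (g x).im)).comp x him) hI
  rw [key, h.isCovariantDerivative.add d1 d2, h.isCovariantDerivative.leibniz hσ hre,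
    h.isCovariantDerivative.leibniz hI him]
  simp only [add_apply, smul_apply,
    ContinuousLinearMap.smulRight_apply, dre, dim, h.smul_I σ x hσ v]
  change ((g x).re : ℂ) • cov σ x v + ((mvfderiv I g x v).re : ℂ) • σ x +
    (((g x).im : ℂ) • Complex.I • cov σ x v + ((mvfderiv I g x v).im : ℂ) • Complex.I • σ x) = _
  conv_rhs => rw [← Complex.re_add_im (g x), ← Complex.re_add_im (mvfderiv I g x v)]
  module

/-- The connection form of `cov` with respect to `lineFrame V x₀`. -/
def connectionForm (cov : ConnectionMap I V) (x₀ x : B) : TangentSpace I x →L[ℝ] ℂ :=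
  (trivializationAt ℂ V x₀).continuousLinearMapAt ℝ x ∘L cov (lineFrame V x₀) x

theorem connectionForm_apply (cov : ConnectionMap I V) {x₀ x : B} (hx : x ∈ frameDomain V x₀)
    (v : TangentSpace I x) :
    connectionForm cov x₀ x v = lineCoord x₀ (cov (lineFrame V x₀) x v) := by
  rw [connectionForm, ContinuousLinearMap.comp_apply, Trivialization.continuousLinearMapAt_apply,
    Trivialization.coe_linearMapAt_of_mem _ hx]; rfl

theorem cov_lineFrame (cov : ConnectionMap I V) {x₀ x : B} (hx : x ∈ frameDomain V x₀)
    (v : TangentSpace I x) :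
    cov (lineFrame V x₀) x v = connectionForm cov x₀ x v • lineFrame V x₀ x := by
  rw [connectionForm_apply cov hx]; exact eq_lineCoord_smul hx _

theorem IsHermitianConnection.congr [ContMDiffVectorBundle ∞ ℂ V I]
    {H : HermitianMetric I V} {cov : ConnectionMap I V} (h : IsHermitianConnection H cov)
    {σ τ : Π x : B, V x} {x : B} (hσ : DifferentiableSectionAt I σ x)
    (hτ : DifferentiableSectionAt I τ x) (heq : ∀ᶠ y in 𝓝 x, σ y = τ y) : cov σ x = cov τ x :=
  h.isCovariantDerivative.congr_of_eventuallyEq hσ hτ Filter.univ_mem heq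

/-- The covariant derivative of a section in terms of the connection form. -/
theorem IsHermitianConnection.eq_connectionForm [ContMDiffVectorBundle ∞ ℂ V I]
    {H : HermitianMetric I V} {cov : ConnectionMap I V} (h : IsHermitianConnection H cov)
    {σ : Π x : B, V x} {x₀ x : B} (hx : x ∈ frameDomain V x₀)
    (hσ : DifferentiableSectionAt I σ x) (v : TangentSpace I x) :
    cov σ x v = (mvfderiv I (fun y ↦ lineCoord x₀ (σ y)) x v +
      lineCoord x₀ (σ x) * connectionForm cov x₀ x v) • lineFrame V x₀ x := by
  have hg := (differentiableSectionAt_iff hx σ).1 hσ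
  have hs := (smoothSectionAt_lineFrame (I := I) hx).differentiableSectionAt
  have h1 := h.leibniz_complex hg hs v
  rw [cov_lineFrame cov hx, smul_smul, ← add_smul] at h1
  rw [← h1]
  -- The section equals its coordinate times the frame only on the frame domain, so locality of the
  -- connection is needed.
  refine congrArg (fun T : TangentSpace I x →L[ℝ] V x ↦ T v)
    (h.congr hσ (DifferentiableSectionAt.smul hg hs) ?_)
  filter_upwards [(trivializationAt ℂ V x₀).open_baseSet.mem_nhds hx] with y hy
  exact eq_lineCoord_smul hy _

end Frame
-- Smoothness of the connection form, via bump functions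
section GlobalFrame

variable {E : Type*} [NormedAddCommGroup E] [NormedSpace ℝ E] [FiniteDimensional ℝ E]
  {K : Type*} [TopologicalSpace K] {I : ModelWithCorners ℝ E K}
  {B : Type*} [TopologicalSpace B] [T2Space B] [ChartedSpace K B] [IsManifold I ∞ B]
  {V : B → Type*} [TopologicalSpace (TotalSpace ℂ V)]
  [∀ x, AddCommGroup (V x)] [∀ x, Module ℂ (V x)] [∀ x, TopologicalSpace (V x)]
  [∀ x, IsTopologicalAddGroup (V x)] [∀ x, ContinuousSMul ℂ (V x)]
  [FiberBundle ℂ V] [VectorBundle ℂ ℂ V] [ContMDiffVectorBundle ∞ ℂ V I]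

variable (I V) in
/-- Near `x₀`, the local frame agrees with a globally smooth section. -/
theorem exists_smooth_section_eq_lineFrame (x₀ : B) :
    ∃ s : Π x : B, V x, (∀ x, SmoothSectionAt I s x) ∧ ∀ᶠ x in 𝓝 x₀, s x = lineFrame V x₀ x := by
  have hx₀ : x₀ ∈ frameDomain V x₀ := mem_baseSet_trivializationAt ℂ V x₀
  have hopen := (trivializationAt ℂ V x₀).open_baseSet
  obtain ⟨ρ, -, hρ⟩ := (SmoothBumpFunction.nhds_basis_tsupport (I := I) x₀).mem_iff.1
    (hopen.mem_nhds hx₀)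
  refine ⟨fun x ↦ ρ x • lineFrame V x₀ x, fun x ↦ ?_, ?_⟩
  · by_cases hx : x ∈ tsupport ρ
    · exact ContMDiffAt.smul_section (V := V) ρ.contMDiffAt (smoothSectionAt_lineFrame (hρ hx))
    · refine ((Bundle.contMDiff_zeroSection ℝ V) x).congr_of_eventuallyEq ?_
      filter_upwards [(isClosed_tsupport ρ).isOpen_compl.mem_nhds hx] with y hy
      have : ρ y = 0 := image_eq_zero_of_notMem_tsupport hy
      simp [this, zeroSection]
  · filter_upwards [ρ.eventuallyEq_one] with x hx
    rw [hx]
    exact one_smul ℝ _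

/-- The covariant derivative of a local frame is smooth. -/
theorem IsHermitianConnection.contMDiffAt_cov_lineFrame
    {H : HermitianMetric I V} {cov : ConnectionMap I V} (h : IsHermitianConnection H cov) (x₀ : B) :
    ContMDiffAt I (I.prod 𝓘(ℝ, E →L[ℝ] ℂ)) ∞
      (fun x ↦ (⟨x, cov (lineFrame V x₀) x⟩ :
        TotalSpace (E →L[ℝ] ℂ) fun x ↦ TangentSpace I x →L[ℝ] V x)) x₀ := by
  -- Smoothness of the connection is tested on sections smooth on all of `B`; the frame is therefore
  -- replaced by a global section with the same germ at `x₀`.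
  obtain ⟨s, hs, hs₀⟩ := exists_smooth_section_eq_lineFrame I V x₀
  have hx₀ : x₀ ∈ frameDomain V x₀ := mem_baseSet_trivializationAt ℂ V x₀
  have h1 := h.smooth.contMDiff (σ := s) fun x _ ↦ (hs x).contMDiffWithinAt
  refine ((h1 x₀ trivial).contMDiffAt Filter.univ_mem).congr_of_eventuallyEq ?_
  filter_upwards [hs₀.eventually_nhds,
    (trivializationAt ℂ V x₀).open_baseSet.mem_nhds hx₀] with x hx hx'
  refine congrArg (TotalSpace.mk x) (h.congr ?_ (hs x).differentiableSectionAt ?_)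
  · exact (smoothSectionAt_lineFrame hx').differentiableSectionAt
  · filter_upwards [hx] with y hy using hy.symm

/-- The connection form of a smooth connection is smooth in coordinates. -/
theorem IsHermitianConnection.contMDiffAt_connectionForm
    {H : HermitianMetric I V} {cov : ConnectionMap I V} (h : IsHermitianConnection H cov) (x₀ : B) :
    ContMDiffAt I 𝓘(ℝ, E →L[ℝ] ℂ) ∞ (fun x ↦ (connectionForm cov x₀ x ∘L
      (trivializationAt E (TangentSpace I) x₀).symmL ℝ x : E →L[ℝ] ℂ)) x₀ :=
  ((contMDiffAt_hom_bundle _).1 (h.contMDiffAt_cov_lineFrame x₀)).2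

end GlobalFrame

/-! ### The pulled back connection in an arbitrary local frame -/

section Pullback

variable {E : Type*} [NormedAddCommGroup E] [NormedSpace ℝ E]
  {K : Type*} [TopologicalSpace K] {I : ModelWithCorners ℝ E K}
  {B : Type*} [TopologicalSpace B] [ChartedSpace K B] [IsManifold I ∞ B]
  {V : B → Type*} [TopologicalSpace (TotalSpace ℂ V)]
  [∀ x, AddCommGroup (V x)] [∀ x, Module ℂ (V x)] [∀ x, TopologicalSpace (V x)]
  [∀ x, IsTopologicalAddGroup (V x)] [∀ x, ContinuousSMul ℂ (V x)]
  [FiberBundle ℂ V] [VectorBundle ℂ ℂ V] [ContMDiffVectorBundle ∞ ℂ V I]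
  {E' : Type*} [NormedAddCommGroup E'] [NormedSpace ℝ E']
  {K' : Type*} [TopologicalSpace K'] {I' : ModelWithCorners ℝ E' K'}
  {N : Type*} [TopologicalSpace N] [ChartedSpace K' N] [IsManifold I' ∞ N]

/-- The pull-back of the connection form, plus a multiple of a 1-form: this is the connection form
of `f^*∇ + c α` with respect to the pulled back frame. -/
def pullbackForm (cov : ConnectionMap I V) (f : C^∞⟮I', N; I, B⟯) (c : ℂ)
    (α : Π x : N, TangentSpace I' x →L[ℝ] ℝ) (x₀ : B) (y : N) : TangentSpace I' y →L[ℝ] ℂ :=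
  connectionForm cov x₀ (f y) ∘L mfderiv I' I f y + (α y).smulRight c

theorem pullbackForm_apply (cov : ConnectionMap I V) (f : C^∞⟮I', N; I, B⟯) (c : ℂ)
    (α : Π x : N, TangentSpace I' x →L[ℝ] ℝ) (x₀ : B) (y : N) (w : TangentSpace I' y) :
    pullbackForm cov f c α x₀ y w =
      connectionForm cov x₀ (f y) (mfderiv I' I f y w) + α y w * c := by
  simp only [pullbackForm, add_apply, ContinuousLinearMap.comp_apply,
    ContinuousLinearMap.smulRight_apply, Complex.real_smul]

/-- The pull-back of a trivialization of `V` belongs to the trivialization atlas of f^*V, so any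
frame of `V` around `f y` can be used as a test. -/
theorem differentiableSectionAt_pullback_iff (f : C^∞⟮I', N; I, B⟯) {x₀ : B} {y : N}
    (hy : f y ∈ frameDomain V x₀) (σ : Π u : N, (f *ᵖ V) u) :
    DifferentiableSectionAt I' σ y ↔
      MDifferentiableAt I' 𝓘(ℝ, ℂ) (fun z ↦ lineCoord (V := V) (x := f z) x₀ (σ z)) y :=
  haveI : MemTrivializationAtlas ((trivializationAt ℂ V x₀).pullback f) :=
    ⟨_, inferInstance, rfl⟩
  ((trivializationAt ℂ V x₀).pullback f).mdifferentiableAt_section_iff I' σ hy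

theorem smoothSectionAt_pullback_iff (f : C^∞⟮I', N; I, B⟯) {x₀ : B} {y : N}
    (hy : f y ∈ frameDomain V x₀) (σ : Π u : N, (f *ᵖ V) u) {k : ℕ∞ω} [ENat.LEInfty k] :
    ContMDiffAt I' (I'.prod 𝓘(ℝ, ℂ)) k (fun z ↦ TotalSpace.mk' ℂ z (σ z)) y ↔
      ContMDiffAt I' 𝓘(ℝ, ℂ) k (fun z ↦ lineCoord (V := V) (x := f z) x₀ (σ z)) y :=
  haveI : MemTrivializationAtlas ((trivializationAt ℂ V x₀).pullback f) :=
    ⟨_, inferInstance, rfl⟩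
  ((trivializationAt ℂ V x₀).pullback f).contMDiffAt_section_iff hy

/-- The pull-back connection is given by the pulled back connection form, for every local frame. -/
theorem IsHermitianConnection.addOneForm_pullback_eq
    {H : HermitianMetric I V} {cov : ConnectionMap I V} (h : IsHermitianConnection H cov)
    (f : C^∞⟮I', N; I, B⟯) (c : ℂ) (α : Π x : N, TangentSpace I' x →L[ℝ] ℝ)
    {x₀ : B} {y : N} (hy : f y ∈ frameDomain V x₀) {σ : Π u : N, (f *ᵖ V) u}
    (hσ : DifferentiableSectionAt I' σ y) (w : TangentSpace I' y) :
    addOneForm (pullbackConnection cov f) c α σ y w =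
      ((mvfderiv I' (fun z ↦ lineCoord (V := V) (x := f z) x₀ (σ z)) y w +
        lineCoord (V := V) (x := f y) x₀ (σ y) * pullbackForm cov f c α x₀ y w) •
          lineFrame V x₀ (f y) : V (f y)) := by
  have hy' : f y ∈ frameDomain V (f y) := mem_baseSet_trivializationAt ℂ V (f y)
  -- `pullbackConnection` uses at `y` the preferred frame at `f y`, which moves with `y`. The
  -- function `h₁` is the transition function from that frame to the fixed frame at `x₀`; the claim
  -- is the gauge invariance of dg + g β under this change.
  set h₁ : B → ℂ := fun x ↦ lineCoord x₀ (lineFrame V (f y) x) with hh₁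
  set g : N → ℂ := fun z ↦ lineCoord (V := V) (x := f z) (f y) (σ z) with hg
  have hs := (smoothSectionAt_lineFrame (I := I) hy').differentiableSectionAt
  have dh : MDifferentiableAt I 𝓘(ℝ, ℂ) h₁ (f y) := (differentiableSectionAt_iff hy _).1 hs
  have dg : MDifferentiableAt I' 𝓘(ℝ, ℂ) g y := (differentiableSectionAt_pullback_iff f hy' σ).1 hσ
  have df : MDifferentiableAt I' I f y := f.contMDiff.mdifferentiableAt (by simp)
  have hcoord : (fun z ↦ lineCoord (V := V) (x := f z) x₀ (σ z)) =ᶠ[𝓝 y]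
      g * (h₁ ∘ f) := by
    have o := ((trivializationAt ℂ V x₀).open_baseSet.inter
      (trivializationAt ℂ V (f y)).open_baseSet).mem_nhds ⟨hy, hy'⟩
    filter_upwards [f.contMDiff.continuous.continuousAt.preimage_mem_nhds o] with z hz
    conv_lhs => rw [eq_lineCoord_smul (V := V) (x := f z) hz.2 (σ z)]
    exact lineCoord_smul hz.1 _ _
  have e1 : mvfderiv I' (fun z ↦ lineCoord (V := V) (x := f z) x₀ (σ z)) y w =
      g y * mvfderiv I h₁ (f y) (mfderiv I' I f y w) + h₁ (f y) * mvfderiv I' g y w := by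
    have e0 : mvfderiv I' (fun z ↦ lineCoord (V := V) (x := f z) x₀ (σ z)) y w =
        mvfderiv I' (g * (h₁ ∘ f)) y w := by
      have := hcoord.mfderiv_eq (I := I') (I' := 𝓘(ℝ, ℂ))
      exact congrArg (fun T : E' →L[ℝ] ℂ ↦ T w) this
    have dhf : MDifferentiableAt I' 𝓘(ℝ, ℂ) (h₁ ∘ f) y := dh.comp y df
    have e2 : HasMFDerivAt I' 𝓘(ℝ, ℂ) (g * (h₁ ∘ f)) y _ := dg.hasMFDerivAt.mul dhf.hasMFDerivAt
    have e3 : mfderiv I' 𝓘(ℝ, ℂ) (h₁ ∘ f) y = _ := mfderiv_comp y dh df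
    rw [e0]
    change mfderiv I' 𝓘(ℝ, ℂ) (g * (h₁ ∘ f)) y w = _
    rw [e2.mfderiv, e3]
    rfl
  set v : V (f y) := σ y with hv
  have e2 : lineCoord (V := V) (x := f y) x₀ v = g y * h₁ (f y) := hcoord.self_of_nhds
  have e3 : v = lineCoord (V := V) (x := f y) x₀ v • lineFrame V x₀ (f y) :=
    eq_lineCoord_smul hy _
  have e4 : addOneForm (pullbackConnection cov f) c α σ y w =
      (mvfderiv I' g y w • lineFrame V (f y) (f y) +
        g y • cov (lineFrame V (f y)) (f y) (mfderiv I' I f y w) +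
        (α y w : ℂ) • (c • v) : V (f y)) := rfl
  set s₀ : V (f y) := lineFrame V x₀ (f y)
  have e5 : lineFrame V (f y) (f y) = h₁ (f y) • s₀ := eq_lineCoord_smul hy _
  have e6 : cov (lineFrame V (f y)) (f y) (mfderiv I' I f y w) =
    (mvfderiv I h₁ (f y) (mfderiv I' I f y w) +
      h₁ (f y) * connectionForm cov x₀ (f y) (mfderiv I' I f y w)) • s₀ :=
    h.eq_connectionForm hy hs _
  rw [e2] at e3
  rw [e4, e6, e5, pullbackForm_apply, e1, e2, e3]
  -- Both sides are now multiples of the same frame vector. The coefficients agree by the product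
  -- rule for g · (h₁ ∘ f), the term in dh₁ being the inhomogeneous part of the change of connection
  -- form.
  simp only [smul_smul, ← add_smul]
  congr 1
  ring

end Pullback
-- Coordinate vector fields and derivatives of pulled back forms
section Coordinates

variable {E : Type*} [NormedAddCommGroup E] [NormedSpace ℝ E]
  {M : Type*} [TopologicalSpace M] [ChartedSpace E M] [IsManifold 𝓘(ℝ, E) ∞ M]
  {W : Type*} [NormedAddCommGroup W] [NormedSpace ℝ W]
  {F : Type*} [NormedAddCommGroup F] [NormedSpace ℝ F]

/-- The coordinate vector field `∂_a` near `x₀`. -/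
def coordField (x₀ : M) (a : E) : Π x : M, TangentSpace 𝓘(ℝ, E) x := fun x ↦
  (trivializationAt E (TangentSpace 𝓘(ℝ, E)) x₀).symmL ℝ x a

theorem smoothFieldAt_coordField (x₀ : M) (a : E) :
    SmoothFieldAt (I := 𝓘(ℝ, E)) (coordField x₀ a) x₀ := by
  set e := trivializationAt E (TangentSpace 𝓘(ℝ, E) : M → Type _) x₀
  have he : x₀ ∈ e.baseSet := mem_baseSet_trivializationAt E (TangentSpace 𝓘(ℝ, E)) x₀
  refine (contMDiffAt_section (E := (TangentSpace 𝓘(ℝ, E) : M → Type _)) x₀).2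
    ((contMDiffAt_const (c := a)).congr_of_eventuallyEq ?_)
  filter_upwards [e.open_baseSet.mem_nhds he] with y hy
  have h : coordField x₀ a y = e.symm y a := e.symmL_apply (R := ℝ) hy a
  rw [h]
  exact congrArg Prod.snd (e.apply_mk_symm hy a)

/-- The inverse of the preferred trivialization of the tangent bundle is the differential of the
inverse chart, so in the chart a coordinate field is constant. -/
theorem mpullbackWithin_coordField {x₀ : M} (a : E) {y : E}
    (hy : y ∈ (extChartAt 𝓘(ℝ, E) x₀).target) :
    VectorField.mpullbackWithin 𝓘(ℝ, E) 𝓘(ℝ, E) (extChartAt 𝓘(ℝ, E) x₀).symm (coordField x₀ a)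
      (Set.range 𝓘(ℝ, E)) y = a := by
  have hx : (extChartAt 𝓘(ℝ, E) x₀).symm y ∈ (chartAt E x₀).source := by
    rw [← extChartAt_source 𝓘(ℝ, E)]; exact (extChartAt 𝓘(ℝ, E) x₀).map_target hy
  rw [VectorField.mpullbackWithin_apply, coordField, TangentBundle.symmL_trivializationAt hx,
    (extChartAt 𝓘(ℝ, E) x₀).right_inv hy]
  have hinv := isInvertible_mfderivWithin_extChartAt_symm hy
  exact hinv.inverse_apply_eq.2 rfl

/-- The bracket is computed in the chart, where both fields are constant near the base point.
Consequently the bracket terms drop out of the curvature and closedness conditions when these are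
tested on coordinate fields. -/
theorem mlieBracket_coordField (x₀ : M) (a b : E) :
    VectorField.mlieBracket 𝓘(ℝ, E) (coordField x₀ a) (coordField x₀ b) x₀ = 0 := by
  rw [← VectorField.mlieBracketWithin_univ, VectorField.mlieBracketWithin_apply]
  have hU : (extChartAt 𝓘(ℝ, E) x₀).target ∈ 𝓝 (extChartAt 𝓘(ℝ, E) x₀ x₀) :=
    extChartAt_target_mem_nhds x₀
  have ha (a : E) : VectorField.mpullbackWithin 𝓘(ℝ, E) 𝓘(ℝ, E) (extChartAt 𝓘(ℝ, E) x₀).symm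
      (coordField x₀ a) (Set.range 𝓘(ℝ, E)) =ᶠ[𝓝 (extChartAt 𝓘(ℝ, E) x₀ x₀)] fun _ ↦ a := by
    filter_upwards [hU] with y hy using mpullbackWithin_coordField a hy
  have h0 (X Y : E → E) (S : Set E) (p : E) (hS : S = Set.univ) (hX : X =ᶠ[𝓝 p] fun _ ↦ a)
      (hY : Y =ᶠ[𝓝 p] fun _ ↦ b) : VectorField.lieBracketWithin ℝ X Y S p = 0 := by
    rw [hS, VectorField.lieBracketWithin_univ, hX.lieBracket_vectorField_eq hY]
    simp [VectorField.lieBracket]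
  exact (congrArg _ (h0 _ _ _ _ (by simp) (ha a) (ha b))).trans (map_zero _)

theorem continuousLinearMapAt_mfderiv {x₀ : M} {Φ : W → M} {q : W}
    (hΦ : MDifferentiableAt 𝓘(ℝ, W) 𝓘(ℝ, E) Φ q) (hq : Φ q ∈ (chartAt E x₀).source) (b : W) :
    (trivializationAt E (TangentSpace 𝓘(ℝ, E)) x₀).continuousLinearMapAt ℝ (Φ q)
      (mfderiv 𝓘(ℝ, W) 𝓘(ℝ, E) Φ q b) = fderiv ℝ (extChartAt 𝓘(ℝ, E) x₀ ∘ Φ) q b := by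
  rw [TangentBundle.continuousLinearMapAt_trivializationAt hq, ← mfderiv_eq_fderiv]
  exact (mfderiv_comp_apply q (mdifferentiableAt_extChartAt hq) hΦ b).symm

/-- This writes a pulled back form as a coefficient function evaluated on derivatives of the
coordinate expression of Φ, which the product rule in normed spaces can differentiate. -/
theorem mfderiv_eq_coordField {x₀ : M} {Φ : W → M} {q : W}
    (hΦ : MDifferentiableAt 𝓘(ℝ, W) 𝓘(ℝ, E) Φ q) (hq : Φ q ∈ (chartAt E x₀).source) (b : W) :
    mfderiv 𝓘(ℝ, W) 𝓘(ℝ, E) Φ q b =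
      coordField x₀ (fderiv ℝ (extChartAt 𝓘(ℝ, E) x₀ ∘ Φ) q b) (Φ q) := by
  rw [← continuousLinearMapAt_mfderiv hΦ hq b, coordField]
  exact ((trivializationAt E (TangentSpace 𝓘(ℝ, E)) x₀).symmL_continuousLinearMapAt hq _).symm

theorem contDiffAt_coord_comp {Φ : W → M} {p : W} {k : ℕ∞ω} [ENat.LEInfty k]
    (hΦ : ContMDiffAt 𝓘(ℝ, W) 𝓘(ℝ, E) k Φ p) :
    ContDiffAt ℝ k (extChartAt 𝓘(ℝ, E) (Φ p) ∘ Φ) p :=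
  ((contMDiffAt_extChartAt (n := k)).comp p hΦ).contDiffAt

theorem eventually_mdifferentiableAt {Φ : W → M} {p : W}
    (hΦ : ContMDiffAt 𝓘(ℝ, W) 𝓘(ℝ, E) 2 Φ p) :
    ∀ᶠ q in 𝓝 p, MDifferentiableAt 𝓘(ℝ, W) 𝓘(ℝ, E) Φ q ∧ Φ q ∈ (chartAt E (Φ p)).source := by
  filter_upwards [(contMDiffAt_iff_contMDiffAt_nhds (by simp)).1 hΦ,
    hΦ.continuousAt.preimage_mem_nhds
    ((chartAt E (Φ p)).open_source.mem_nhds (mem_chart_source E (Φ p)))] with q h1 h2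
  exact ⟨h1.mdifferentiableAt (by simp), h2⟩

/-- The exterior derivative of the pull-back of a 1-form, evaluated on constant vectors. -/
theorem fderiv_pullback_oneForm {Φ : W → M} {p : W} (hΦ : ContMDiffAt 𝓘(ℝ, W) 𝓘(ℝ, E) 2 Φ p)
    (A : Π x : M, TangentSpace 𝓘(ℝ, E) x →L[ℝ] F)
    (hA : MDifferentiableAt 𝓘(ℝ, E) 𝓘(ℝ, E →L[ℝ] F)
      (fun x ↦ (A x ∘L (trivializationAt E (TangentSpace 𝓘(ℝ, E)) (Φ p)).symmL ℝ x : E →L[ℝ] F))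
      (Φ p)) (a b : W) :
    let a' := fderiv ℝ (extChartAt 𝓘(ℝ, E) (Φ p) ∘ Φ) p a
    let b' := fderiv ℝ (extChartAt 𝓘(ℝ, E) (Φ p) ∘ Φ) p b
    fderiv ℝ (fun q ↦ A (Φ q) (mfderiv 𝓘(ℝ, W) 𝓘(ℝ, E) Φ q b)) p a
      - fderiv ℝ (fun q ↦ A (Φ q) (mfderiv 𝓘(ℝ, W) 𝓘(ℝ, E) Φ q a)) p b =
    mvfderiv 𝓘(ℝ, E) (fun x ↦ A x (coordField (Φ p) b' x)) (Φ p) (coordField (Φ p) a' (Φ p))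
      - mvfderiv 𝓘(ℝ, E) (fun x ↦ A x (coordField (Φ p) a' x)) (Φ p)
          (coordField (Φ p) b' (Φ p)) := by
  intro a' b'
  set α : M → E →L[ℝ] F := fun x ↦
    A x ∘L (trivializationAt E (TangentSpace 𝓘(ℝ, E)) (Φ p)).symmL ℝ x
  set G := extChartAt 𝓘(ℝ, E) (Φ p) ∘ Φ
  have hG2 : ContDiffAt ℝ 2 G p := contDiffAt_coord_comp hΦ
  have hΦ1 : MDifferentiableAt 𝓘(ℝ, W) 𝓘(ℝ, E) Φ p := hΦ.mdifferentiableAt (by simp)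
  have hαΦ : DifferentiableAt ℝ (α ∘ Φ) p := (hA.comp p hΦ1).differentiableAt
  have hdG : DifferentiableAt ℝ (fderiv ℝ G) p :=
    (hG2.fderiv_right (m := 1) (by norm_num)).differentiableAt (by simp)
  -- Besides the derivative of the coefficients along coordinate fields, the product rule produces a
  -- term in the second derivative of the coordinate expression `G`. It is symmetric in `a` and `b`
  -- and cancels in the difference.
  have key (a b : W) : fderiv ℝ (fun q ↦ A (Φ q) (mfderiv 𝓘(ℝ, W) 𝓘(ℝ, E) Φ q b)) p a =
      mvfderiv 𝓘(ℝ, E) (fun x ↦ A x (coordField (Φ p) (fderiv ℝ G p b) x)) (Φ p)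
        (coordField (Φ p) (fderiv ℝ G p a) (Φ p)) + α (Φ p) (fderiv ℝ (fderiv ℝ G) p a b) := by
    have e1 : (fun q ↦ A (Φ q) (mfderiv 𝓘(ℝ, W) 𝓘(ℝ, E) Φ q b)) =ᶠ[𝓝 p]
        fun q ↦ (α ∘ Φ) q (fderiv ℝ G q b) := by
      filter_upwards [eventually_mdifferentiableAt hΦ] with q hq
      rw [mfderiv_eq_coordField hq.1 hq.2]
      rfl
    have e2 : HasFDerivAt (fun q ↦ fderiv ℝ G q b) _ p :=
      hdG.hasFDerivAt.clm_apply (hasFDerivAt_const b p)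
    rw [e1.fderiv_eq, (hαΦ.hasFDerivAt.clm_apply e2).fderiv]
    have e3 : mvfderiv 𝓘(ℝ, E) (fun x ↦ α x (fderiv ℝ G p b)) (Φ p)
        (mfderiv 𝓘(ℝ, W) 𝓘(ℝ, E) Φ p a) = fderiv ℝ (fun q ↦ (α ∘ Φ) q (fderiv ℝ G p b)) p a := by
      rw [← mfderiv_eq_fderiv (f := fun q ↦ (α ∘ Φ) q (fderiv ℝ G p b))]
      have : MDifferentiableAt 𝓘(ℝ, E) 𝓘(ℝ, F) (fun x ↦ α x (fderiv ℝ G p b)) (Φ p) :=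
        hA.clm_apply mdifferentiableAt_const
      exact (mfderiv_comp_apply p this hΦ1 a).symm
    rw [← mfderiv_eq_coordField hΦ1 (mem_chart_source E (Φ p))]
    have e4 : (fun x ↦ A x (coordField (Φ p) (fderiv ℝ G p b) x)) =
      fun x ↦ α x (fderiv ℝ G p b) := rfl
    rw [e4, e3, (hαΦ.hasFDerivAt.clm_apply (hasFDerivAt_const _ p)).fderiv]
    simp [add_comm]
  have hsymm : fderiv ℝ (fderiv ℝ G) p a b = fderiv ℝ (fderiv ℝ G) p b a :=
    (hG2.isSymmSndFDerivAt (by simp)).eq a b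
  rw [key, key, hsymm]
  abel

/-- The derivative of the pull-back of a 2-form evaluated on constant vectors. -/
theorem fderiv_pullback_twoForm {Φ : W → M} {p : W} (hΦ : ContMDiffAt 𝓘(ℝ, W) 𝓘(ℝ, E) 2 Φ p)
    (η : Π x : M, TangentSpace 𝓘(ℝ, E) x →L[ℝ] TangentSpace 𝓘(ℝ, E) x →L[ℝ] F)
    {α : M → E →L[ℝ] E →L[ℝ] F} (hα : MDifferentiableAt 𝓘(ℝ, E) 𝓘(ℝ, E →L[ℝ] E →L[ℝ] F) α (Φ p))
    (hαη : ∀ᶠ x in 𝓝 (Φ p), ∀ v w,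
      η x (coordField (Φ p) v x) (coordField (Φ p) w x) = α x v w) (a b c : W) :
    let G := extChartAt 𝓘(ℝ, E) (Φ p) ∘ Φ
    fderiv ℝ (fun q ↦ η (Φ q) (mfderiv 𝓘(ℝ, W) 𝓘(ℝ, E) Φ q b)
        (mfderiv 𝓘(ℝ, W) 𝓘(ℝ, E) Φ q c)) p a =
      mvfderiv 𝓘(ℝ, E) (fun x ↦ η x (coordField (Φ p) (fderiv ℝ G p b) x)
        (coordField (Φ p) (fderiv ℝ G p c) x)) (Φ p) (coordField (Φ p) (fderiv ℝ G p a) (Φ p))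
      + α (Φ p) (fderiv ℝ (fderiv ℝ G) p a b) (fderiv ℝ G p c)
      + α (Φ p) (fderiv ℝ G p b) (fderiv ℝ (fderiv ℝ G) p a c) := by
  intro G
  have hG2 : ContDiffAt ℝ 2 G p := contDiffAt_coord_comp hΦ
  have hΦ1 : MDifferentiableAt 𝓘(ℝ, W) 𝓘(ℝ, E) Φ p := hΦ.mdifferentiableAt (by simp)
  have hαΦ : DifferentiableAt ℝ (α ∘ Φ) p := (hα.comp p hΦ1).differentiableAt
  have hdG : DifferentiableAt ℝ (fderiv ℝ G) p :=
    (hG2.fderiv_right (m := 1) (by norm_num)).differentiableAt (by simp)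
  have e1 : (fun q ↦ η (Φ q) (mfderiv 𝓘(ℝ, W) 𝓘(ℝ, E) Φ q b)
      (mfderiv 𝓘(ℝ, W) 𝓘(ℝ, E) Φ q c)) =ᶠ[𝓝 p]
      fun q ↦ (α ∘ Φ) q (fderiv ℝ G q b) (fderiv ℝ G q c) := by
    filter_upwards [eventually_mdifferentiableAt hΦ, hΦ.continuousAt.eventually hαη] with q hq h
    rw [mfderiv_eq_coordField hq.1 hq.2, mfderiv_eq_coordField hq.1 hq.2]
    exact h _ _
  have e2 (b : W) : HasFDerivAt (fun q ↦ fderiv ℝ G q b) _ p :=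
    hdG.hasFDerivAt.clm_apply (hasFDerivAt_const b p)
  rw [e1.fderiv_eq, ((hαΦ.hasFDerivAt.clm_apply (e2 b)).clm_apply (e2 c)).fderiv]
  set β : M → F := fun x ↦ α x (fderiv ℝ G p b) (fderiv ℝ G p c)
  have e3 : mvfderiv 𝓘(ℝ, E) β (Φ p) (mfderiv 𝓘(ℝ, W) 𝓘(ℝ, E) Φ p a) =
      fderiv ℝ (β ∘ Φ) p a := by
    rw [← mfderiv_eq_fderiv (f := β ∘ Φ)]
    have : MDifferentiableAt 𝓘(ℝ, E) 𝓘(ℝ, F) β (Φ p) :=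
      (hα.clm_apply mdifferentiableAt_const).clm_apply mdifferentiableAt_const
    exact (mfderiv_comp_apply p this hΦ1 a).symm
  have e4 : mvfderiv 𝓘(ℝ, E) (fun x ↦ η x (coordField (Φ p) (fderiv ℝ G p b) x)
        (coordField (Φ p) (fderiv ℝ G p c) x)) (Φ p) = mvfderiv 𝓘(ℝ, E) β (Φ p) := by
    have : (fun x ↦ η x (coordField (Φ p) (fderiv ℝ G p b) x)
        (coordField (Φ p) (fderiv ℝ G p c) x)) =ᶠ[𝓝 (Φ p)] β := by
      filter_upwards [hαη] with x hx using hx _ _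
    exact this.mfderiv_eq (I := 𝓘(ℝ, E)) (I' := 𝓘(ℝ, F))
  have e5 : HasFDerivAt (β ∘ Φ) _ p :=
    (hαΦ.hasFDerivAt.clm_apply (hasFDerivAt_const (fderiv ℝ G p b) p)).clm_apply
      (hasFDerivAt_const (fderiv ℝ G p c) p)
  rw [← mfderiv_eq_coordField hΦ1 (mem_chart_source E (Φ p)), e4, e3, e5.fderiv]
  simp
  abel

end Coordinates
-- The curvature as exterior derivative of the connection form
section PullbackForms

variable {E : Type*} [NormedAddCommGroup E] [NormedSpace ℝ E]
  {B : Type*} [TopologicalSpace B] [ChartedSpace E B] [IsManifold 𝓘(ℝ, E) ∞ B]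
  {V : B → Type*} [TopologicalSpace (TotalSpace ℂ V)]
  [∀ x, AddCommGroup (V x)] [∀ x, Module ℂ (V x)] [∀ x, TopologicalSpace (V x)]
  [∀ x, IsTopologicalAddGroup (V x)] [∀ x, ContinuousSMul ℂ (V x)]
  [FiberBundle ℂ V] [VectorBundle ℂ ℂ V] [ContMDiffVectorBundle ∞ ℂ V 𝓘(ℝ, E)]
  {W : Type*} [NormedAddCommGroup W] [NormedSpace ℝ W]

theorem lineCoord_cov_eventuallyEq (cov : ConnectionMap 𝓘(ℝ, E) V) (x₀ : B)
    (X : Π x : B, TangentSpace 𝓘(ℝ, E) x) :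
    (fun y ↦ lineCoord x₀ (cov (lineFrame V x₀) y (X y))) =ᶠ[𝓝 x₀]
      fun y ↦ connectionForm cov x₀ y (X y) := by
  filter_upwards [(trivializationAt ℂ V x₀).open_baseSet.mem_nhds
    (mem_baseSet_trivializationAt ℂ V x₀)] with y hy
  exact (connectionForm_apply cov hy _).symm

/-- The curvature, in terms of the connection form and coordinate vector fields. -/
theorem IsHermitianConnection.exteriorDeriv_connectionForm
    [FiniteDimensional ℝ E] [T2Space B]
    {H : HermitianMetric 𝓘(ℝ, E) V} {cov : ConnectionMap 𝓘(ℝ, E) V}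
    (h : IsHermitianConnection H cov)
    {Ω : ∀ x : B, TangentSpace 𝓘(ℝ, E) x → TangentSpace 𝓘(ℝ, E) x → ℝ}
    (hΩ : HasCurvature cov Ω) (x₀ : B) (a b : E) :
    mvfderiv 𝓘(ℝ, E) (fun x ↦ connectionForm cov x₀ x (coordField x₀ b x)) x₀ (coordField x₀ a x₀)
      - mvfderiv 𝓘(ℝ, E) (fun x ↦ connectionForm cov x₀ x (coordField x₀ a x)) x₀
        (coordField x₀ b x₀) =
      -(Complex.I * (Ω x₀ (coordField x₀ a x₀) (coordField x₀ b x₀) : ℂ)) := by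
  have hx₀ : x₀ ∈ frameDomain V x₀ := mem_baseSet_trivializationAt ℂ V x₀
  set s := lineFrame V x₀
  have hd (b : E) : MDifferentiableAt 𝓘(ℝ, E) 𝓘(ℝ, ℂ)
      (fun x ↦ connectionForm cov x₀ x (coordField x₀ b x)) x₀ :=
    ((h.contMDiffAt_connectionForm x₀).mdifferentiableAt (by simp)).clm_apply
      (mdifferentiableAt_const (c := b))
  have hsec (b : E) : DifferentiableSectionAt 𝓘(ℝ, E) (fun y ↦ cov s y (coordField x₀ b y)) x₀ :=
    (differentiableSectionAt_iff hx₀ _).2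
      ((hd b).congr_of_eventuallyEq (lineCoord_cov_eventuallyEq cov x₀ _))
  -- With A the connection form, ∇_a ∇_b s = (∂_a A_b + A_b A_a) s. The quadratic term is symmetric
  -- because ℂ is commutative, so only dA survives the antisymmetrization.
  have key (a b : E) : cov (fun y ↦ cov s y (coordField x₀ b y)) x₀ (coordField x₀ a x₀) =
      (mvfderiv 𝓘(ℝ, E) (fun x ↦ connectionForm cov x₀ x (coordField x₀ b x)) x₀
        (coordField x₀ a x₀) + connectionForm cov x₀ x₀ (coordField x₀ b x₀) *
          connectionForm cov x₀ x₀ (coordField x₀ a x₀)) • s x₀ := by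
    rw [h.eq_connectionForm hx₀ (hsec b)]
    have e := lineCoord_cov_eventuallyEq cov x₀ (coordField x₀ b)
    have e1 : mvfderiv 𝓘(ℝ, E) (fun y ↦ lineCoord x₀ (cov s y (coordField x₀ b y))) x₀ =
        mvfderiv 𝓘(ℝ, E) (fun x ↦ connectionForm cov x₀ x (coordField x₀ b x)) x₀ :=
      e.mfderiv_eq (I := 𝓘(ℝ, E)) (I' := 𝓘(ℝ, ℂ))
    rw [e1, connectionForm_apply cov hx₀ (coordField x₀ b x₀)]
  have hc := hΩ (coordField x₀ a) (coordField x₀ b) s x₀ (smoothFieldAt_coordField x₀ a)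
    (smoothFieldAt_coordField x₀ b) (smoothSectionAt_lineFrame hx₀)
  rw [mlieBracket_coordField, map_zero, sub_zero, key, key, ← sub_smul] at hc
  have := smul_left_injective ℂ (lineFrame_ne_zero (V := V) hx₀) hc
  rw [← this]
  ring

/-- The exterior derivative of the pulled back connection form is the pulled back curvature. -/
theorem IsHermitianConnection.fderiv_pullback_connectionForm
    [FiniteDimensional ℝ E] [T2Space B]
    {H : HermitianMetric 𝓘(ℝ, E) V} {cov : ConnectionMap 𝓘(ℝ, E) V}
    (h : IsHermitianConnection H cov)
    {Ω : ∀ x : B, TangentSpace 𝓘(ℝ, E) x → TangentSpace 𝓘(ℝ, E) x → ℝ}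
    (hΩ : HasCurvature cov Ω) {Φ : W → B} {p : W} (hΦ : ContMDiffAt 𝓘(ℝ, W) 𝓘(ℝ, E) 2 Φ p)
    (a b : W) :
    fderiv ℝ (fun q ↦ connectionForm cov (Φ p) (Φ q) (mfderiv 𝓘(ℝ, W) 𝓘(ℝ, E) Φ q b)) p a
      - fderiv ℝ (fun q ↦ connectionForm cov (Φ p) (Φ q) (mfderiv 𝓘(ℝ, W) 𝓘(ℝ, E) Φ q a)) p b =
      -(Complex.I * (Ω (Φ p) (mfderiv 𝓘(ℝ, W) 𝓘(ℝ, E) Φ p a)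
        (mfderiv 𝓘(ℝ, W) 𝓘(ℝ, E) Φ p b) : ℂ)) := by
  have hΦ1 : MDifferentiableAt 𝓘(ℝ, W) 𝓘(ℝ, E) Φ p := hΦ.mdifferentiableAt (by simp)
  rw [fderiv_pullback_oneForm hΦ (connectionForm cov (Φ p))
    ((h.contMDiffAt_connectionForm (Φ p)).mdifferentiableAt (by simp)) a b,
    h.exteriorDeriv_connectionForm hΩ,
    ← mfderiv_eq_coordField hΦ1 (mem_chart_source E (Φ p)),
    ← mfderiv_eq_coordField hΦ1 (mem_chart_source E (Φ p))]

/-- Near `y` the form is a composition of smooth data: the coordinate coefficients of the connection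
form along `f`, the derivative of `f` in a chart, and the added 1-form. -/
theorem contDiffAt_pullbackForm [FiniteDimensional ℝ E] [T2Space B]
    {H : HermitianMetric 𝓘(ℝ, E) V} {cov : ConnectionMap 𝓘(ℝ, E) V}
    (h : IsHermitianConnection H cov) (f : C^∞⟮𝓘(ℝ, W), W; 𝓘(ℝ, E), B⟯) (c : ℂ)
    {α : W → W →L[ℝ] ℝ} (hα : ContDiff ℝ ∞ α) (y : W) :
    ContDiffAt ℝ ∞ (F := W →L[ℝ] ℂ) (fun z ↦ pullbackForm cov f c α (f y) z) y := by
  have hf : ContMDiffAt 𝓘(ℝ, W) 𝓘(ℝ, E) ∞ f y := f.contMDiff.contMDiffAt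
  have h1 : ContDiffAt ℝ ∞ (fun z ↦ (connectionForm cov (f y) (f z) ∘L
      (trivializationAt E (TangentSpace 𝓘(ℝ, E)) (f y)).symmL ℝ (f z) : E →L[ℝ] ℂ)) y :=
    ((h.contMDiffAt_connectionForm (f y)).comp y hf).contDiffAt
  have h2 : ContDiffAt ℝ ∞ (fderiv ℝ (extChartAt 𝓘(ℝ, E) (f y) ∘ f)) y :=
    (contDiffAt_coord_comp hf).fderiv_right (m := ∞) (by simp)
  have h3 : ContDiffAt ℝ ∞ (fun z ↦ (α z).smulRight c) y :=
    ((ContinuousLinearMap.smulRightL ℝ W ℂ).flip c).contDiff.contDiffAt.comp y hα.contDiffAt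
  refine ((h1.clm_comp h2).add h3).congr_of_eventuallyEq ?_
  filter_upwards [eventually_mdifferentiableAt (hf.of_le ENat.LEInfty.out)] with z hz
  refine ContinuousLinearMap.ext fun w ↦ ?_
  refine (pullbackForm_apply cov f c α (f y) z w).trans ?_
  exact congrArg (fun v ↦ connectionForm cov (f y) (f z) v + (α z w : ℂ) * c)
    (mfderiv_eq_coordField hz.1 hz.2 w)

end PullbackForms

/-! ### Pull-backs of a symplectic form are closed -/

section Closed

variable {m : ℕ} {M : Type*} [TopologicalSpace M] [ChartedSpace (EuclideanSpace ℝ (Fin m)) M]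
  [IsManifold (𝓡 m) ∞ M] {W : Type*} [NormedAddCommGroup W] [NormedSpace ℝ W]

theorem SymplecticForm.antisymm (symp : SymplecticForm m M) (x : M) (v w : TangentSpace (𝓡 m) x) :
    symp.form x v w = -symp.form x w v := by
  have h := symp.alternating x (v + w)
  simp only [map_add, add_apply, symp.alternating x v, symp.alternating x w] at h
  linarith

/-- Reading the smooth section `symp.form` in the hom-bundle trivialization gives coefficients with
values in a fixed normed space. -/
theorem SymplecticForm.exists_coord (symp : SymplecticForm m M) (x₀ : M) :
    ∃ α : M → EuclideanSpace ℝ (Fin m) →L[ℝ] EuclideanSpace ℝ (Fin m) →L[ℝ] ℝ,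
      MDifferentiableAt (𝓡 m)
        𝓘(ℝ, EuclideanSpace ℝ (Fin m) →L[ℝ] EuclideanSpace ℝ (Fin m) →L[ℝ] ℝ) α x₀ ∧
      ∀ᶠ x in 𝓝 x₀, ∀ v w,
        symp.form x (coordField x₀ v x) (coordField x₀ w x) = α x v w := by
  have h := ((contMDiffAt_section (E := fun x : M ↦ TangentSpace (𝓡 m) x →L[ℝ]
    TangentSpace (𝓡 m) x →L[ℝ] Bundle.Trivial M ℝ x) x₀).1 (symp.smooth x₀)).mdifferentiableAt
    (by simp)
  refine ⟨_, h, ?_⟩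
  set e := trivializationAt (EuclideanSpace ℝ (Fin m)) (TangentSpace (𝓡 m) : M → Type _) x₀
  filter_upwards [e.open_baseSet.mem_nhds (mem_baseSet_trivializationAt _ _ x₀)] with x hx v w
  have := inCoordinates_apply_eq₂ (𝕜 := ℝ) (F₁ := EuclideanSpace ℝ (Fin m))
    (F₂ := EuclideanSpace ℝ (Fin m)) (F₃ := ℝ)
    (E₁ := (TangentSpace (𝓡 m) : M → Type _)) (E₂ := (TangentSpace (𝓡 m) : M → Type _))
    (E₃ := Bundle.Trivial M ℝ) (x₀ := x₀) (x := x) (ϕ := symp.form x) (v := v) (w := w) hx hx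
    (Set.mem_univ _)
  refine Eq.trans ?_ this.symm
  have hs (v : EuclideanSpace ℝ (Fin m)) : coordField x₀ v x = e.symm x v :=
    e.symmL_apply (R := ℝ) hx v
  rw [hs, hs]
  simp
  rfl

/-- The pull-back of a symplectic form is closed, evaluated on constant vectors. -/
theorem SymplecticForm.fderiv_pullback_cyclic (symp : SymplecticForm m M) {Φ : W → M} {p : W}
    (hΦ : ContMDiffAt 𝓘(ℝ, W) (𝓡 m) 2 Φ p) (a b c : W) :
    let η (v w : W) (q : W) : ℝ := symp.form (Φ q) (mfderiv 𝓘(ℝ, W) (𝓡 m) Φ q v)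
      (mfderiv 𝓘(ℝ, W) (𝓡 m) Φ q w)
    fderiv ℝ (η b c) p a + fderiv ℝ (η c a) p b + fderiv ℝ (η a b) p c = 0 := by
  intro η
  obtain ⟨α, hα, hαη⟩ := symp.exists_coord (Φ p)
  set G := extChartAt (𝓡 m) (Φ p) ∘ Φ
  -- Closedness is tested on the coordinate fields whose values at Φ p are the images of `a`, `b`,
  -- `c`; all brackets vanish there.
  have hcl := symp.closed (coordField (Φ p) (fderiv ℝ G p a)) (coordField (Φ p) (fderiv ℝ G p b))
    (coordField (Φ p) (fderiv ℝ G p c)) (Φ p) (smoothFieldAt_coordField _ _)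
    (smoothFieldAt_coordField _ _) (smoothFieldAt_coordField _ _)
  simp only [mlieBracket_coordField, map_zero, zero_apply, sub_zero] at hcl
  have e (a b c : W) := fderiv_pullback_twoForm hΦ symp.form hα hαη a b c
  have hG2 : ContDiffAt ℝ 2 G p := contDiffAt_coord_comp hΦ
  have hsymm (a b : W) : fderiv ℝ (fderiv ℝ G) p a b = fderiv ℝ (fderiv ℝ G) p b a :=
    (hG2.isSymmSndFDerivAt (by simp)).eq a b
  have hanti (v w : EuclideanSpace ℝ (Fin m)) : α (Φ p) v w = -α (Φ p) w v := by
    rw [← hαη.self_of_nhds, ← hαη.self_of_nhds]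
    exact symp.antisymm _ _ _
  simp only [η, e]
  -- The six second-derivative terms cancel in pairs, since second derivatives are symmetric and the
  -- coefficients are antisymmetric.
  rw [hsymm b a, hsymm c a, hsymm c b, hanti (fderiv ℝ G p b), hanti (fderiv ℝ G p c),
    hanti (fderiv ℝ G p a)]
  linarith

end Closed
-- Curvature of f^*∇ + c α on a vector space
section PullbackConnection

variable {E : Type*} [NormedAddCommGroup E] [NormedSpace ℝ E] [FiniteDimensional ℝ E]
  {B : Type*} [TopologicalSpace B] [T2Space B] [ChartedSpace E B] [IsManifold 𝓘(ℝ, E) ∞ B]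
  {V : B → Type*} [TopologicalSpace (TotalSpace ℂ V)]
  [∀ x, AddCommGroup (V x)] [∀ x, Module ℂ (V x)] [∀ x, TopologicalSpace (V x)]
  [∀ x, IsTopologicalAddGroup (V x)] [∀ x, ContinuousSMul ℂ (V x)]
  [FiberBundle ℂ V] [VectorBundle ℂ ℂ V] [ContMDiffVectorBundle ∞ ℂ V 𝓘(ℝ, E)]
  {W : Type*} [NormedAddCommGroup W] [NormedSpace ℝ W]
  {H : HermitianMetric 𝓘(ℝ, E) V} {cov : ConnectionMap 𝓘(ℝ, E) V}

/-- The coordinate of a section of the pulled back bundle. -/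
def pullbackCoord (f : C^∞⟮𝓘(ℝ, W), W; 𝓘(ℝ, E), B⟯) (x₀ : B) (σ : Π u : W, (f *ᵖ V) u) : W → ℂ :=
  fun z ↦ lineCoord (V := V) (x := f z) x₀ (σ z)

theorem differentiableAt_pullbackCoord_iff (f : C^∞⟮𝓘(ℝ, W), W; 𝓘(ℝ, E), B⟯) {x₀ : B} {y : W}
    (hy : f y ∈ frameDomain V x₀) {σ : Π u : W, (f *ᵖ V) u} :
    DifferentiableSectionAt 𝓘(ℝ, W) σ y ↔ DifferentiableAt ℝ (pullbackCoord f x₀ σ) y :=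
  (differentiableSectionAt_pullback_iff f hy σ).trans mdifferentiableAt_iff_differentiableAt

theorem contDiffAt_pullbackCoord_iff (f : C^∞⟮𝓘(ℝ, W), W; 𝓘(ℝ, E), B⟯) {x₀ : B} {y : W}
    (hy : f y ∈ frameDomain V x₀) {σ : Π u : W, (f *ᵖ V) u} :
    SmoothSectionAt 𝓘(ℝ, W) σ y ↔ ContDiffAt ℝ ∞ (pullbackCoord f x₀ σ) y :=
  (smoothSectionAt_pullback_iff f hy σ).trans contMDiffAt_iff_contDiffAt

theorem eventually_mem_frameDomain (f : C^∞⟮𝓘(ℝ, W), W; 𝓘(ℝ, E), B⟯) (y : W) :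
    ∀ᶠ z in 𝓝 y, f z ∈ frameDomain V (f y) :=
  f.contMDiff.continuous.continuousAt.preimage_mem_nhds
    ((trivializationAt ℂ V (f y)).open_baseSet.mem_nhds (mem_baseSet_trivializationAt ℂ V (f y)))

theorem IsHermitianConnection.addOneForm_pullback_apply (h : IsHermitianConnection H cov)
    (f : C^∞⟮𝓘(ℝ, W), W; 𝓘(ℝ, E), B⟯) (c : ℂ) (α : W → W →L[ℝ] ℝ)
    {x₀ : B} {y : W} (hy : f y ∈ frameDomain V x₀) {σ : Π u : W, (f *ᵖ V) u}
    (hσ : DifferentiableSectionAt 𝓘(ℝ, W) σ y) (w : W) :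
    addOneForm (pullbackConnection cov f) c α σ y w =
      ((fderiv ℝ (pullbackCoord f x₀ σ) y w +
        pullbackCoord f x₀ σ y * pullbackForm cov f c α x₀ y w) •
          lineFrame V x₀ (f y) : V (f y)) := by
  rw [h.addOneForm_pullback_eq f c α hy hσ w, ← mfderiv_eq_fderiv]
  rfl

theorem IsHermitianConnection.pullbackCoord_addOneForm_pullback (h : IsHermitianConnection H cov)
    (f : C^∞⟮𝓘(ℝ, W), W; 𝓘(ℝ, E), B⟯) (c : ℂ) (α : W → W →L[ℝ] ℝ)
    {x₀ : B} {y : W} (hy : f y ∈ frameDomain V x₀) {σ : Π u : W, (f *ᵖ V) u}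
    (hσ : DifferentiableSectionAt 𝓘(ℝ, W) σ y) (w : W) :
    lineCoord (V := V) (x := f y) x₀ (addOneForm (pullbackConnection cov f) c α σ y w) =
      fderiv ℝ (pullbackCoord f x₀ σ) y w +
        pullbackCoord f x₀ σ y * pullbackForm cov f c α x₀ y w := by
  rw [h.addOneForm_pullback_apply f c α hy hσ w, lineCoord_smul hy, lineCoord_lineFrame hy, mul_one]

/-- If `β` is the connection form of `f^*∇ + c α`, its curvature is given by `dβ`. -/
theorem IsHermitianConnection.hasCurvature_addOneForm_pullback (h : IsHermitianConnection H cov)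
    (f : C^∞⟮𝓘(ℝ, W), W; 𝓘(ℝ, E), B⟯) (c : ℂ) {α : W → W →L[ℝ] ℝ} (hα : ContDiff ℝ ∞ α)
    {Ω : W → W → W → ℝ}
    (hΩ : ∀ y a b, fderiv ℝ (fun z ↦ pullbackForm cov f c α (f y) z b) y a
      - fderiv ℝ (fun z ↦ pullbackForm cov f c α (f y) z a) y b = -(Complex.I * (Ω y a b : ℂ))) :
    HasCurvature (I := 𝓘(ℝ, W)) (addOneForm (pullbackConnection cov f) c α) Ω := by
  intro X Y σ y hX hY hσ
  have hy : f y ∈ frameDomain V (f y) := mem_baseSet_trivializationAt ℂ V (f y)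
  replace hX : DifferentiableAt ℝ (X : W → W) y :=
    (contMDiffAt_vectorSpace_iff_contDiffAt.1 hX).differentiableAt (by simp)
  replace hY : DifferentiableAt ℝ (Y : W → W) y :=
    (contMDiffAt_vectorSpace_iff_contDiffAt.1 hY).differentiableAt (by simp)
  set D := addOneForm (pullbackConnection cov f) c α with hD
  set g := pullbackCoord f (f y) σ with hg
  set β : W → W →L[ℝ] ℂ := fun z ↦ pullbackForm cov f c α (f y) z
  have hg1 : ContDiffAt ℝ ∞ g y := (contDiffAt_pullbackCoord_iff f hy).1 hσ
  have hg2 : ContDiffAt ℝ 2 g y := hg1.of_le ENat.LEInfty.out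
  have hβ1 : DifferentiableAt ℝ β y :=
    (contDiffAt_pullbackForm h f c hα y).differentiableAt (by simp)
  have hgev : ∀ᶠ z in 𝓝 y, DifferentiableSectionAt 𝓘(ℝ, W) σ z ∧ f z ∈ frameDomain V (f y) := by
    filter_upwards [hg2.eventually (by simp), eventually_mem_frameDomain (V := V) f y] with z h1 h2
    exact ⟨(differentiableAt_pullbackCoord_iff f h2).2 (h1.differentiableAt (by simp)), h2⟩
  have hdg : DifferentiableAt ℝ (fderiv ℝ g) y :=
    (hg2.fderiv_right (m := 1) (by norm_num)).differentiableAt (by simp)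
  -- An identity on a neighbourhood is required here because the covariant derivative is about to be
  -- differentiated again; this is why the formula in a fixed frame is needed.
  have hev (Y : W → W) : pullbackCoord f (f y) (fun z ↦ D σ z (Y z)) =ᶠ[𝓝 y]
      fun z ↦ fderiv ℝ g z (Y z) + g z * β z (Y z) := by
    filter_upwards [hgev] with z hz
    exact h.pullbackCoord_addOneForm_pullback f c α hz.2 hz.1 _
  have hgd : HasFDerivAt g (fderiv ℝ g y) y := (hg2.differentiableAt (by simp)).hasFDerivAt
  -- In the coefficient of ∇_X ∇_Y σ the derivative of β is taken with `Y` frozen at `y`, and the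
  -- variation of `Y` appears in separate terms. After antisymmetrization the latter give ∇_[X,Y] σ,
  -- the symmetric terms cancel, and g dβ(X, Y) is left.
  have key (X Y : W → W) (hY : DifferentiableAt ℝ Y y) :
      D (fun z ↦ D σ z (Y z)) y (X y) =
        ((fderiv ℝ (fderiv ℝ g) y (X y) (Y y) + fderiv ℝ g y (fderiv ℝ Y y (X y)) +
          g y * fderiv ℝ (fun z ↦ β z (Y y)) y (X y) + g y * β y (fderiv ℝ Y y (X y)) +
          (fderiv ℝ g y (X y) * β y (Y y) + fderiv ℝ g y (Y y) * β y (X y)) +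
          g y * β y (X y) * β y (Y y)) • lineFrame V (f y) (f y) : V (f y)) := by
    have hd : HasFDerivAt (fun z ↦ fderiv ℝ g z (Y z) + g z * β z (Y z)) _ y :=
      (hdg.hasFDerivAt.clm_apply hY.hasFDerivAt).add
        (hgd.mul (hβ1.hasFDerivAt.clm_apply hY.hasFDerivAt))
    have hdiff : DifferentiableSectionAt 𝓘(ℝ, W) (fun z ↦ D σ z (Y z)) y :=
      (differentiableAt_pullbackCoord_iff f hy).2
        (hd.differentiableAt.congr_of_eventuallyEq (hev Y))
    refine (h.addOneForm_pullback_apply f c α hy hdiff (X y)).trans ?_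
    have hb : HasFDerivAt (fun z ↦ β z (Y y)) _ y :=
      hβ1.hasFDerivAt.clm_apply (hasFDerivAt_const _ y)
    rw [(hev Y).fderiv_eq, (hev Y).self_of_nhds, hd.fderiv, hb.fderiv]
    congr 1
    simp only [add_apply, smul_apply, ContinuousLinearMap.comp_apply, smul_eq_mul,
      ContinuousLinearMap.flip_apply, zero_apply, map_zero]
    change _ + _ * β y (X y) = _
    ring
  have hsymm : fderiv ℝ (fderiv ℝ g) y (X y) (Y y) = fderiv ℝ (fderiv ℝ g) y (Y y) (X y) :=
    (hg2.isSymmSndFDerivAt (by simp)).eq _ _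
  have hbr : VectorField.mlieBracket 𝓘(ℝ, W) X Y y =
      fderiv ℝ (Y : W → W) y (X y) - fderiv ℝ (X : W → W) y (Y y) := by
    rw [← VectorField.mlieBracketWithin_univ]
    exact (congrFun (VectorField.mlieBracketWithin_eq_lieBracketWithin (𝕜 := ℝ) (V := X) (W := Y)
      (s := Set.univ)) y).trans
      (congrFun (VectorField.lieBracketWithin_univ (𝕜 := ℝ) (V := (X : W → W)) (W := Y)) y)
  have h3 := h.addOneForm_pullback_apply f c α hy hgev.self_of_nhds.1
    (fderiv ℝ (Y : W → W) y (X y) - fderiv ℝ (X : W → W) y (Y y))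
  have h4 : (σ y : V (f y)) = g y • lineFrame V (f y) (f y) := eq_lineCoord_smul hy _
  have h5 : fderiv ℝ (fun z ↦ β z (Y y)) y (X y) - fderiv ℝ (fun z ↦ β z (X y)) y (Y y) =
    -(Complex.I * (Ω y (X y) (Y y) : ℂ)) := hΩ y (X y) (Y y)
  have k1 := key X Y hY
  have k2 := key Y X hX
  set s₀ : V (f y) := lineFrame V (f y) (f y)
  -- The fibre of f^*V over `y` is by definition `V (f y)`; the computation is carried out in the
  -- latter.
  have goal : ∀ (v1 v2 v3 v4 : V (f y)), v1 = D (fun z ↦ D σ z (Y z)) y (X y) →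
      v2 = D (fun z ↦ D σ z (X z)) y (Y y) →
      v3 = D σ y (fderiv ℝ (Y : W → W) y (X y) - fderiv ℝ (X : W → W) y (Y y)) →
      v4 = σ y → v1 - v2 - v3 = -(Complex.I * (Ω y (X y) (Y y) : ℂ)) • v4 := by
    rintro v1 v2 v3 v4 e1 e2 e3 e4
    rw [e1.trans k1, e2.trans k2, e3.trans h3, e4.trans h4, ← h5, smul_smul, ← sub_smul, ← sub_smul]
    congr 1
    change _ - _ - (fderiv ℝ g y _ + g y * β y _) = _
    rw [map_sub, map_sub, hsymm]
    ring
  rw [hbr]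
  exact goal _ _ _ _ rfl rfl rfl rfl

end PullbackConnection
-- f^*∇ + c α is a Hermitian connection for imaginary c
section PullbackHermitian

variable {E : Type*} [NormedAddCommGroup E] [NormedSpace ℝ E] [FiniteDimensional ℝ E]
  {B : Type*} [TopologicalSpace B] [T2Space B] [ChartedSpace E B] [IsManifold 𝓘(ℝ, E) ∞ B]
  {V : B → Type*} [TopologicalSpace (TotalSpace ℂ V)]
  [∀ x, AddCommGroup (V x)] [∀ x, Module ℂ (V x)] [∀ x, TopologicalSpace (V x)]
  [∀ x, IsTopologicalAddGroup (V x)] [∀ x, ContinuousSMul ℂ (V x)]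
  [FiberBundle ℂ V] [VectorBundle ℂ ℂ V] [ContMDiffVectorBundle ∞ ℂ V 𝓘(ℝ, E)]
  {W : Type*} [NormedAddCommGroup W] [NormedSpace ℝ W]
  {H : HermitianMetric 𝓘(ℝ, E) V} {cov : ConnectionMap 𝓘(ℝ, E) V}

theorem IsHermitianConnection.addOneForm_pullback_add (h : IsHermitianConnection H cov)
    (f : C^∞⟮𝓘(ℝ, W), W; 𝓘(ℝ, E), B⟯) (c : ℂ) (α : W → W →L[ℝ] ℝ) {σ τ : Π u : W, (f *ᵖ V) u}
    {y : W} (hσ : DifferentiableSectionAt 𝓘(ℝ, W) σ y) (hτ : DifferentiableSectionAt 𝓘(ℝ, W) τ y)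
    (w : W) :
    addOneForm (pullbackConnection cov f) c α (σ + τ) y w =
      (addOneForm (pullbackConnection cov f) c α σ y w +
        addOneForm (pullbackConnection cov f) c α τ y w : V (f y)) := by
  have hy : f y ∈ frameDomain V (f y) := mem_baseSet_trivializationAt ℂ V (f y)
  have d1 := (differentiableAt_pullbackCoord_iff f hy).1 hσ
  have d2 := (differentiableAt_pullbackCoord_iff f hy).1 hτ
  have hev : pullbackCoord f (f y) (σ + τ) =ᶠ[𝓝 y]
      fun z ↦ pullbackCoord f (f y) σ z + pullbackCoord f (f y) τ z := by
    filter_upwards [eventually_mem_frameDomain (V := V) f y] with z hz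
    exact lineCoord_add hz _ _
  have hd := d1.hasFDerivAt.add d2.hasFDerivAt
  have hστ : DifferentiableSectionAt 𝓘(ℝ, W) (σ + τ) y :=
    (differentiableAt_pullbackCoord_iff f hy).2 (hd.differentiableAt.congr_of_eventuallyEq hev)
  rw [h.addOneForm_pullback_apply f c α hy hσ, h.addOneForm_pullback_apply f c α hy hτ]
  refine (h.addOneForm_pullback_apply f c α hy hστ w).trans (Eq.trans ?_ (add_smul _ _ _))
  rw [hev.fderiv_eq, hev.self_of_nhds]
  congr 1
  refine Eq.trans (congrArg (fun T : W →L[ℝ] ℂ ↦ T w + _) hd.fderiv) ?_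
  simp only [add_apply]
  ring

/-- Allowing complex-valued `g` covers both the real Leibniz rule and, for the constant √-1, complex
linearity. -/
theorem IsHermitianConnection.addOneForm_pullback_leibniz (h : IsHermitianConnection H cov)
    (f : C^∞⟮𝓘(ℝ, W), W; 𝓘(ℝ, E), B⟯) (c : ℂ) (α : W → W →L[ℝ] ℝ) {σ : Π u : W, (f *ᵖ V) u}
    {g : W → ℂ} {y : W} (hg : DifferentiableAt ℝ g y) (hσ : DifferentiableSectionAt 𝓘(ℝ, W) σ y)
    (w : W) :
    addOneForm (pullbackConnection cov f) c α (fun z ↦ g z • σ z) y w =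
      (g y • addOneForm (pullbackConnection cov f) c α σ y w + fderiv ℝ g y w • σ y :
        (f *ᵖ V) y) := by
  have hy : f y ∈ frameDomain V (f y) := mem_baseSet_trivializationAt ℂ V (f y)
  have d1 := (differentiableAt_pullbackCoord_iff f hy).1 hσ
  have hev : pullbackCoord f (f y) (fun z ↦ g z • σ z) =ᶠ[𝓝 y]
      fun z ↦ g z * pullbackCoord f (f y) σ z := by
    filter_upwards [eventually_mem_frameDomain (V := V) f y] with z hz
    exact lineCoord_smul hz _ _
  have hd := hg.hasFDerivAt.mul d1.hasFDerivAt
  have hgσ : DifferentiableSectionAt 𝓘(ℝ, W) (fun z ↦ g z • σ z) y :=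
    (differentiableAt_pullbackCoord_iff f hy).2 (hd.differentiableAt.congr_of_eventuallyEq hev)
  have h4 : (σ y : V (f y)) = pullbackCoord f (f y) σ y • lineFrame V (f y) (f y) :=
    eq_lineCoord_smul hy _
  refine (h.addOneForm_pullback_apply f c α hy hgσ w).trans ?_
  rw [h.addOneForm_pullback_apply f c α hy hσ]
  refine Eq.trans ?_ (congrArg (fun v : V (f y) ↦ g y • ((fderiv ℝ (pullbackCoord f (f y) σ) y w +
    pullbackCoord f (f y) σ y * pullbackForm cov f c α (f y) y w) • lineFrame V (f y) (f y)) +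
      fderiv ℝ g y w • v) h4.symm)
  rw [hev.fderiv_eq, hev.self_of_nhds, smul_smul, smul_smul, ← add_smul]
  congr 1
  refine Eq.trans (congrArg (fun T : W →L[ℝ] ℂ ↦ T w + _) hd.fderiv) ?_
  simp only [add_apply, smul_apply, smul_eq_mul]
  ring

/-- In the pulled back trivialization the covariant derivative is dg + g β, with g and β smooth; the
tangent bundle of the vector space `W` is trivialized by the identity. -/
theorem IsHermitianConnection.contMDiffAt_addOneForm_pullback (h : IsHermitianConnection H cov)
    (f : C^∞⟮𝓘(ℝ, W), W; 𝓘(ℝ, E), B⟯) (c : ℂ) {α : W → W →L[ℝ] ℝ} (hα : ContDiff ℝ ∞ α)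
    {σ : Π u : W, (f *ᵖ V) u} {y : W} (hσ : SmoothSectionAt 𝓘(ℝ, W) σ y) :
    ContMDiffAt 𝓘(ℝ, W) (𝓘(ℝ, W).prod 𝓘(ℝ, W →L[ℝ] ℂ)) ∞
      (fun x ↦ (⟨x, addOneForm (pullbackConnection cov f) c α σ x⟩ :
        TotalSpace (W →L[ℝ] ℂ) fun x ↦ TangentSpace 𝓘(ℝ, W) x →L[ℝ] (f *ᵖ V) x)) y := by
  have hy : f y ∈ frameDomain V (f y) := mem_baseSet_trivializationAt ℂ V (f y)
  refine (contMDiffAt_hom_bundle _).2 ⟨contMDiffAt_id, ?_⟩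
  have h1 : ContDiffAt ℝ ∞ (pullbackCoord f (f y) σ) y :=
    (contDiffAt_pullbackCoord_iff f hy).1 hσ
  have h2 := contDiffAt_pullbackForm h f c hα y
  have h3 : ContDiffAt ℝ ∞ (fderiv ℝ (pullbackCoord f (f y) σ)) y :=
    h1.fderiv_right (m := ∞) (by simp)
  refine (h3.add (h1.smul h2)).contMDiffAt.congr_of_eventuallyEq ?_
  have h4 : ContDiffAt ℝ 1 (pullbackCoord f (f y) σ) y := h1.of_le ENat.LEInfty.out
  filter_upwards [eventually_mem_frameDomain (V := V) f y, h4.eventually (by simp)] with z hz hz'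
  have hσz : DifferentiableSectionAt 𝓘(ℝ, W) σ z :=
    (differentiableAt_pullbackCoord_iff f hz).2 (hz'.differentiableAt (by simp))
  refine ContinuousLinearMap.ext fun w ↦ ?_
  refine Eq.trans ?_ (h.pullbackCoord_addOneForm_pullback f c α hz hσz w)
  have hw : (trivializationAt W (TangentSpace 𝓘(ℝ, W)) y).symmL ℝ z w = w := by
    rw [TangentBundle.symmL_model_space]; rfl
  have hz2 : z ∈ (trivializationAt ℂ (f *ᵖ V) y).baseSet := hz
  change (trivializationAt ℂ (f *ᵖ V) y).continuousLinearMapAt ℝ z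
    (addOneForm (pullbackConnection cov f) c α σ z
      ((trivializationAt W (TangentSpace 𝓘(ℝ, W)) y).symmL ℝ z w)) = _
  rw [Trivialization.continuousLinearMapAt_apply, Trivialization.coe_linearMapAt_of_mem _ hz2]
  exact congrArg (fun w' : W ↦ lineCoord (V := V) (x := f z) (f y)
    (addOneForm (pullbackConnection cov f) c α σ z w')) hw

theorem IsHermitianConnection.addOneForm_pullback_metric (h : IsHermitianConnection H cov)
    (f : C^∞⟮𝓘(ℝ, W), W; 𝓘(ℝ, E), B⟯) {c : ℂ} (hc : c.re = 0) (α : W → W →L[ℝ] ℝ)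
    {σ τ : Π u : W, (f *ᵖ V) u}
    {y : W} (hσ : DifferentiableSectionAt 𝓘(ℝ, W) σ y) (hτ : DifferentiableSectionAt 𝓘(ℝ, W) τ y)
    (w : W) :
    fderiv ℝ (fun z ↦ H.inner (f z) (σ z) (τ z)) y w =
      H.inner (f y) (addOneForm (pullbackConnection cov f) c α σ y w) (τ y) +
        H.inner (f y) (σ y) (addOneForm (pullbackConnection cov f) c α τ y w) := by
  have hy : f y ∈ frameDomain V (f y) := mem_baseSet_trivializationAt ℂ V (f y)
  have hf : MDifferentiableAt 𝓘(ℝ, W) 𝓘(ℝ, E) f y := f.contMDiff.mdifferentiableAt (by simp)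
  set s := lineFrame V (f y)
  have hs : SmoothSectionAt 𝓘(ℝ, E) s (f y) := smoothSectionAt_lineFrame hy
  set g := pullbackCoord f (f y) σ
  set k := pullbackCoord f (f y) τ
  set η : B → ℂ := fun x ↦ H.inner x (s x) (s x)
  have dg : DifferentiableAt ℝ g y := (differentiableAt_pullbackCoord_iff f hy).1 hσ
  have dk : DifferentiableAt ℝ k y := (differentiableAt_pullbackCoord_iff f hy).1 hτ
  have dη : MDifferentiableAt 𝓘(ℝ, E) 𝓘(ℝ, ℂ) η (f y) :=
    (H.smooth s s (f y) hs hs).mdifferentiableAt (by simp)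
  have dηf : DifferentiableAt ℝ (η ∘ f) y := (dη.comp y hf).differentiableAt
  have key {z : W} (hz : f z ∈ frameDomain V (f y)) (a b : V (f z)) :
      H.inner (f z) a b =
        starRingEnd ℂ (lineCoord (f y) a) * lineCoord (f y) b * η (f z) := by
    conv_lhs => rw [eq_lineCoord_smul hz a, eq_lineCoord_smul hz b]
    simp only [map_smulₛₗ, LinearMap.smul_apply, smul_eq_mul, RingHom.id_apply]
    change _ * (_ * η (f z)) = _
    ring
  have hev : (fun z ↦ H.inner (f z) (σ z) (τ z)) =ᶠ[𝓝 y]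
      fun z ↦ starRingEnd ℂ (g z) * k z * (η ∘ f) z := by
    filter_upwards [eventually_mem_frameDomain (V := V) f y] with z hz
    exact key hz _ _
  have dgc : HasFDerivAt (fun z ↦ starRingEnd ℂ (g z))
      ((Complex.conjCLE : ℂ →L[ℝ] ℂ) ∘L fderiv ℝ g y) y :=
    (Complex.conjCLE : ℂ →L[ℝ] ℂ).hasFDerivAt.comp y dg.hasFDerivAt
  have e1 := (dgc.mul dk.hasFDerivAt).mul dηf.hasFDerivAt
  -- Metric compatibility of ∇ is used only for the frame, where it reads dη = (Ā + A) η for η the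
  -- squared norm of `s`. Sesquilinearity extends it to all sections.
  have e2 : fderiv ℝ (η ∘ f) y w =
      (starRingEnd ℂ (connectionForm cov (f y) (f y) (mfderiv 𝓘(ℝ, W) 𝓘(ℝ, E) f y w)) +
        connectionForm cov (f y) (f y) (mfderiv 𝓘(ℝ, W) 𝓘(ℝ, E) f y w)) * η (f y) := by
    have h1 : fderiv ℝ (η ∘ f) y w = mvfderiv 𝓘(ℝ, E) η (f y) (mfderiv 𝓘(ℝ, W) 𝓘(ℝ, E) f y w) := by
      rw [← mfderiv_eq_fderiv (f := η ∘ f)]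
      exact mfderiv_comp_apply y dη hf w
    rw [h1, h.metric s s (f y) hs.differentiableSectionAt hs.differentiableSectionAt,
      cov_lineFrame cov hy]
    simp only [map_smulₛₗ, LinearMap.smul_apply, smul_eq_mul, RingHom.id_apply]
    change _ * η (f y) + _ * η (f y) = _
    ring
  -- This makes the contributions of c α from the two arguments of the metric cancel.
  have hcc : starRingEnd ℂ c = -c := by
    apply Complex.ext <;> simp [hc]
  rw [hev.fderiv_eq]
  refine (congrArg (fun T : W →L[ℝ] ℂ ↦ T w) e1.fderiv).trans ?_
  refine Eq.trans ?_ (congrArg₂ (· + ·) (key hy _ _) (key hy _ _)).symm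
  rw [h.pullbackCoord_addOneForm_pullback f c α hy hσ w,
    h.pullbackCoord_addOneForm_pullback f c α hy hτ w]
  have e3 := pullbackForm_apply cov f c α (f y) y w
  change _ = starRingEnd ℂ (fderiv ℝ g y w + g y * _) * k y * η (f y) +
    starRingEnd ℂ (g y) * (fderiv ℝ k y w + k y * _) * η (f y)
  rw [e3]
  simp only [add_apply, smul_apply, smul_eq_mul, e2, map_add, map_mul, hcc, Complex.conj_ofReal,
    ContinuousLinearMap.comp_apply, ContinuousLinearEquiv.coe_coe, Complex.conjCLE_apply,
    Function.comp_apply, Pi.mul_apply]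
  ring

/-- The connection `f^*∇ + c α` is Hermitian if `c` is purely imaginary. -/
theorem IsHermitianConnection.addOneForm_pullback (h : IsHermitianConnection H cov)
    (f : C^∞⟮𝓘(ℝ, W), W; 𝓘(ℝ, E), B⟯) {c : ℂ} (hc : c.re = 0) {α : W → W →L[ℝ] ℝ}
    (hα : ContDiff ℝ ∞ α) :
    IsHermitianConnection (I := 𝓘(ℝ, W)) (H.pullback f)
      (addOneForm (pullbackConnection cov f) c α) where
  isCovariantDerivative :=
    { add := fun hσ hτ _ ↦ ContinuousLinearMap.ext fun w ↦
        h.addOneForm_pullback_add f c α hσ hτ w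
      leibniz := by
        intro σ g y hσ hg _
        refine ContinuousLinearMap.ext fun w ↦ ?_
        have hg' := Complex.ofRealCLM.hasFDerivAt.comp y hg.differentiableAt.hasFDerivAt
        refine (h.addOneForm_pullback_leibniz f c α (g := fun z ↦ (g z : ℂ))
          hg'.differentiableAt hσ w).trans ?_
        have e : fderiv ℝ (fun z ↦ (g z : ℂ)) y w = ((fderiv ℝ g y w : ℝ) : ℂ) :=
          congrArg (fun T : W →L[ℝ] ℂ ↦ T w) hg'.fderiv
        rw [e, ← mfderiv_eq_fderiv]
        rfl }
  smul_I := by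
    intro σ y hσ w
    refine (h.addOneForm_pullback_leibniz f c α (g := fun _ ↦ Complex.I)
      (differentiableAt_const _) hσ w).trans ?_
    rw [fderiv_fun_const]
    change _ + (0 : ℂ) • (σ y) = _
    rw [zero_smul, add_zero]
  smooth := ⟨fun {σ} hσ y _ ↦ (h.contMDiffAt_addOneForm_pullback f c hα
    ((hσ y trivial).contMDiffAt Filter.univ_mem)).contMDiffWithinAt⟩
  metric := by
    intro σ τ y hσ hτ w
    refine Eq.trans ?_ (h.addOneForm_pullback_metric f hc α hσ hτ w)
    rw [← mfderiv_eq_fderiv]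
    rfl

end PullbackHermitian
-- Integrals over [0, 1] depending on a parameter
section ParametricIntegrals

open MeasureTheory Set

variable {U : Type*} [NormedAddCommGroup U] [NormedSpace ℝ U]
  {F : Type*} [NormedAddCommGroup F] [NormedSpace ℝ F]

theorem uniqueDiffOn_univ_prod_Icc : UniqueDiffOn ℝ (univ ×ˢ Icc 0 1 : Set (U × ℝ)) :=
  uniqueDiffOn_univ.prod (uniqueDiffOn_Icc zero_lt_one)

/-- The derivative in the first variable of a function on `U × [0, 1]`. -/
def fderivParam (K : U × ℝ → F) (p : U × ℝ) : U →L[ℝ] F :=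
  fderivWithin ℝ K (univ ×ˢ Icc 0 1) p ∘L ContinuousLinearMap.inl ℝ U ℝ

/-- Slices v ↦ (v, t) stay inside the strip, so the derivative within the strip restricts to an
honest derivative in the parameter, even at the endpoints of the interval. -/
theorem hasFDerivAt_fderivParam {K : U × ℝ → F} (hK : DifferentiableOn ℝ K (univ ×ˢ Icc 0 1))
    (u : U) {t : ℝ} (ht : t ∈ Icc (0 : ℝ) 1) :
    HasFDerivAt (fun v ↦ K (v, t)) (fderivParam K (u, t)) u := by
  have h1 := (hK (u, t) ⟨mem_univ _, ht⟩).hasFDerivWithinAt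
  have h2 : HasFDerivAt (fun v : U ↦ (v, t)) (ContinuousLinearMap.inl ℝ U ℝ) u :=
    hasFDerivAt_prodMk_left u t
  exact HasFDerivWithinAt.comp_hasFDerivAt (t := univ ×ˢ Icc 0 1) u h1 h2
    (Filter.Eventually.of_forall fun v ↦ mk_mem_prod (mem_univ v) ht)

theorem ContDiffOn.fderivParam_apply {K : U × ℝ → F} {k n : ℕ∞ω}
    (hK : ContDiffOn ℝ n K (univ ×ˢ Icc 0 1)) (hkn : k + 1 ≤ n) (w : U) :
    ContDiffOn ℝ k (fun p ↦ fderivParam K p w) (univ ×ˢ Icc 0 1) :=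
  (hK.fderivWithin uniqueDiffOn_univ_prod_Icc hkn).clm_apply contDiffOn_const

theorem continuousOn_slice {G : Type*} [TopologicalSpace G] {K : U × ℝ → G}
    (hK : ContinuousOn K (univ ×ˢ Icc 0 1)) (u : U) :
    ContinuousOn (fun t ↦ K (u, t)) (Icc 0 1) :=
  hK.comp (f := fun t ↦ (u, t)) (by fun_prop) fun _ ht ↦ ⟨mem_univ _, ht⟩

theorem intervalIntegrable_slice {K : U × ℝ → F} (hK : ContinuousOn K (univ ×ˢ Icc 0 1)) (u : U) :
    IntervalIntegrable (fun t ↦ K (u, t)) volume 0 1 :=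
  (continuousOn_slice hK u).intervalIntegrable_of_Icc zero_le_one

theorem uIoc_zero_one_subset : uIoc (0 : ℝ) 1 ⊆ Icc 0 1 := by
  rw [uIoc_of_le zero_le_one]; exact Ioc_subset_Icc_self

/-- Differentiation under the integral sign over the compact interval `[0, 1]`. -/
theorem hasFDerivAt_integral_slice [FiniteDimensional ℝ U] {K : U × ℝ → F}
    (hK : ContDiffOn ℝ 1 K (univ ×ˢ Icc 0 1)) (u : U) :
    HasFDerivAt (fun u ↦ ∫ t in (0 : ℝ)..1, K (u, t))
      (∫ t in (0 : ℝ)..1, fderivParam K (u, t)) u := by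
  have hd : ContinuousOn (fderivParam K) (univ ×ˢ Icc 0 1) :=
    ((ContinuousLinearMap.compL ℝ U (U × ℝ) F).flip
      (ContinuousLinearMap.inl ℝ U ℝ)).continuous.comp_continuousOn
      (hK.continuousOn_fderivWithin uniqueDiffOn_univ_prod_Icc le_rfl)
  -- The dominating constant comes from compactness of (closed unit ball) × [0, 1], which uses that
  -- `U` is finite-dimensional.
  obtain ⟨C, hC⟩ := ((isCompact_closedBall u 1).prod (isCompact_Icc (a := (0 : ℝ)) (b := 1))
    ).exists_bound_of_continuousOn (hd.mono (prod_mono_left (subset_univ _)))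
  refine intervalIntegral.hasFDerivAt_integral_of_dominated_of_fderiv_le
    (F' := fun u t ↦ fderivParam K (u, t)) (bound := fun _ ↦ C)
    (Metric.closedBall_mem_nhds u one_pos) ?_ (intervalIntegrable_slice hK.continuousOn u)
    ?_ ?_ intervalIntegrable_const ?_
  · exact Filter.Eventually.of_forall fun v ↦
      (intervalIntegrable_iff.1 (intervalIntegrable_slice hK.continuousOn v)).aestronglyMeasurable
  · exact (intervalIntegrable_iff.1 (intervalIntegrable_slice hd u)).aestronglyMeasurable
  · exact Filter.Eventually.of_forall fun t ht v hv ↦ hC _ ⟨hv, uIoc_zero_one_subset ht⟩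
  · exact Filter.Eventually.of_forall fun t ht v _ ↦
      hasFDerivAt_fderivParam (hK.differentiableOn (by simp)) v (uIoc_zero_one_subset ht)

theorem fderiv_integral_slice [FiniteDimensional ℝ U] [CompleteSpace F] {K : U × ℝ → F}
    (hK : ContDiffOn ℝ 1 K (univ ×ˢ Icc 0 1)) (u w : U) :
    fderiv ℝ (fun u ↦ ∫ t in (0 : ℝ)..1, K (u, t)) u w =
      ∫ t in (0 : ℝ)..1, fderivParam K (u, t) w := by
  have hd : ContinuousOn (fderivParam K) (univ ×ˢ Icc 0 1) :=
    ((ContinuousLinearMap.compL ℝ U (U × ℝ) F).flip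
      (ContinuousLinearMap.inl ℝ U ℝ)).continuous.comp_continuousOn
      (hK.continuousOn_fderivWithin uniqueDiffOn_univ_prod_Icc le_rfl)
  rw [(hasFDerivAt_integral_slice hK u).fderiv,
    ContinuousLinearMap.intervalIntegral_apply (intervalIntegrable_slice hd u)]

/-- Each directional derivative of the integral is again the integral of a smooth function on the
strip, so induction on the order applies with the integrand kept general. -/
theorem contDiff_integral_slice [FiniteDimensional ℝ U] [CompleteSpace F] {K : U × ℝ → F}
    (hK : ContDiffOn ℝ ∞ K (univ ×ˢ Icc 0 1)) :
    ContDiff ℝ ∞ (fun u ↦ ∫ t in (0 : ℝ)..1, K (u, t)) := by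
  refine contDiff_infty.2 fun n ↦ ?_
  induction n generalizing K with
  | zero =>
    exact contDiff_zero.2 (continuous_iff_continuousAt.2 fun u ↦
      (hasFDerivAt_integral_slice (hK.of_le (by simp)) u).continuousAt)
  | succ n ih =>
    rw [Nat.cast_add, Nat.cast_one]
    refine contDiff_succ_iff_fderiv_apply.2 ⟨fun u ↦
      (hasFDerivAt_integral_slice (hK.of_le (by simp)) u).differentiableAt, by simp, fun w ↦ ?_⟩
    simp_rw [fderiv_integral_slice (hK.of_le (by simp : (1 : ℕ∞ω) ≤ ∞)) _ w]
    exact ih (hK.fderivParam_apply (k := ∞) (by simp) w)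

/-- Integration by parts of 1 - t against the derivative of the primitive of `b`. Both boundary
terms vanish: the primitive is zero at 0 and the weight is zero at 1. -/
theorem integral_integral_eq_integral_one_sub_mul {b : ℝ → ℝ} (hb : Continuous b) :
    ∫ t in (0 : ℝ)..1, ∫ τ in (0 : ℝ)..t, b τ = ∫ τ in (0 : ℝ)..1, (1 - τ) * b τ := by
  have h := intervalIntegral.integral_mul_deriv_eq_deriv_mul (a := 0) (b := 1)
    (u := fun t ↦ 1 - t) (u' := fun _ ↦ -1) (v := fun t ↦ ∫ τ in (0 : ℝ)..t, b τ) (v' := b)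
    (fun t _ ↦ by simpa using (hasDerivAt_id t).const_sub 1)
    (fun t _ ↦ (hb.integral_hasStrictDerivAt 0 t).hasDerivAt)
    intervalIntegrable_const (hb.intervalIntegrable _ _)
  simpa using h.symm

end ParametricIntegrals

/-! ### The forms λ and ω̃ along a plot, and dλ = ω̃ - ev₀^*ω -/

section PlotForms

open MeasureTheory Set

variable {m : ℕ} {M : Type*} [TopologicalSpace M] [ChartedSpace (EuclideanSpace ℝ (Fin m)) M]
  [IsManifold (𝓡 m) ∞ M] {n : ℕ}

/-- The map `(u, t) ↦ φ(u)(t)` of a plot `φ`, extended to `t ∈ ℝ` by its end values. -/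
def plotUncurry (φ : EuclideanSpace ℝ (Fin n) → PathSpace m M) (p : EuclideanSpace ℝ (Fin n) × ℝ) :
    M :=
  φ p.1 (projIcc 0 1 zero_le_one p.2)

/-- The extension is constant in t outside [0, 1], so smoothness is available only on the closed
strip; this is why derivatives within the strip are used below. -/
theorem contMDiffOn_plotUncurry {φ : EuclideanSpace ℝ (Fin n) → PathSpace m M} (hφ : IsPlot φ) :
    ContMDiffOn 𝓘(ℝ, EuclideanSpace ℝ (Fin n) × ℝ) (𝓡 m) ∞ (plotUncurry φ)
      (univ ×ˢ Icc 0 1) := by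
  have h1 : ContMDiffOn 𝓘(ℝ, EuclideanSpace ℝ (Fin n) × ℝ) (𝓡∂ 1) ∞
      (fun p : EuclideanSpace ℝ (Fin n) × ℝ ↦ projIcc (0 : ℝ) 1 zero_le_one p.2)
      (univ ×ˢ Icc 0 1) :=
    contMDiffOn_projIcc.comp (contDiff_snd.contMDiff.contMDiffOn) fun p hp ↦ hp.2
  have h2 : ContMDiffOn 𝓘(ℝ, EuclideanSpace ℝ (Fin n) × ℝ) (𝓡 n) ∞
      (fun p : EuclideanSpace ℝ (Fin n) × ℝ ↦ p.1) (univ ×ˢ Icc 0 1) :=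
    contDiff_fst.contMDiff.contMDiffOn
  exact ContMDiff.comp_contMDiffOn
    (g := fun p : EuclideanSpace ℝ (Fin n) × unitInterval ↦ φ p.1 p.2) hφ (h2.prodMk h1)

theorem uniqueMDiffOn_univ_prod_Icc {U : Type*} [NormedAddCommGroup U] [NormedSpace ℝ U] :
    UniqueMDiffOn 𝓘(ℝ, U × ℝ) (univ ×ˢ Icc 0 1 : Set (U × ℝ)) :=
  uniqueDiffOn_univ_prod_Icc.uniqueMDiffOn

/-- The differential of `(u, t) ↦ φ(u)(t)` on `ℝⁿ × [0, 1]`. -/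
def plotTangent (φ : EuclideanSpace ℝ (Fin n) → PathSpace m M)
    (p : EuclideanSpace ℝ (Fin n) × ℝ) :
    EuclideanSpace ℝ (Fin n) × ℝ →L[ℝ] TangentSpace (𝓡 m) (plotUncurry φ p) :=
  mfderivWithin 𝓘(ℝ, EuclideanSpace ℝ (Fin n) × ℝ) (𝓡 m) (plotUncurry φ) (univ ×ˢ Icc 0 1) p

theorem contMDiffOn_plotTangent {φ : EuclideanSpace ℝ (Fin n) → PathSpace m M} (hφ : IsPlot φ)
    (v : EuclideanSpace ℝ (Fin n) × ℝ) :
    ContMDiffOn 𝓘(ℝ, EuclideanSpace ℝ (Fin n) × ℝ) (𝓡 m).tangent ∞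
      (fun p ↦ (⟨plotUncurry φ p, plotTangent φ p v⟩ : TangentBundle (𝓡 m) M))
      (univ ×ˢ Icc 0 1) := by
  have h := (contMDiffOn_plotUncurry hφ).contMDiffOn_tangentMapWithin (m := ∞) le_rfl
    uniqueMDiffOn_univ_prod_Icc
  have hv : ContMDiff 𝓘(ℝ, EuclideanSpace ℝ (Fin n) × ℝ)
      𝓘(ℝ, EuclideanSpace ℝ (Fin n) × ℝ).tangent ∞
      (fun p ↦ (⟨p, v⟩ : TangentBundle 𝓘(ℝ, EuclideanSpace ℝ (Fin n) × ℝ)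
        (EuclideanSpace ℝ (Fin n) × ℝ))) := fun p ↦
    (contMDiffAt_vectorSpace_iff_contDiffAt
      (V := fun _ : EuclideanSpace ℝ (Fin n) × ℝ ↦ v)).2 contDiffAt_const
  exact h.comp hv.contMDiffOn fun p hp ↦ hp

/-- The pull-back of a symplectic form along `(u, t) ↦ φ(u)(t)`. -/
def SymplecticForm.onPlot (symp : SymplecticForm m M)
    (φ : EuclideanSpace ℝ (Fin n) → PathSpace m M) (v w p : EuclideanSpace ℝ (Fin n) × ℝ) : ℝ :=
  symp.form (plotUncurry φ p) (plotTangent φ p v) (plotTangent φ p w)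

theorem SymplecticForm.contDiffOn_onPlot (symp : SymplecticForm m M)
    {φ : EuclideanSpace ℝ (Fin n) → PathSpace m M} (hφ : IsPlot φ)
    (v w : EuclideanSpace ℝ (Fin n) × ℝ) :
    ContDiffOn ℝ ∞ (symp.onPlot φ v w) (univ ×ˢ Icc 0 1) := by
  have key : ContMDiffOn 𝓘(ℝ, EuclideanSpace ℝ (Fin n) × ℝ) ((𝓡 m).prod 𝓘(ℝ, ℝ)) ∞
      (fun p ↦ TotalSpace.mk' ℝ (E := Bundle.Trivial M ℝ) (plotUncurry φ p)
        (symp.onPlot φ v w p)) (univ ×ˢ Icc 0 1) :=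
    ContMDiffOn.clm_bundle_apply₂ (F₁ := EuclideanSpace ℝ (Fin m))
      (F₂ := EuclideanSpace ℝ (Fin m)) (symp.smooth.comp_contMDiffOn (contMDiffOn_plotUncurry hφ))
      (contMDiffOn_plotTangent hφ v) (contMDiffOn_plotTangent hφ w)
  exact fun p hp ↦ ((Bundle.contMDiffWithinAt_totalSpace).1 (key p hp)).2.contDiffWithinAt

theorem plotTangent_inl {φ : EuclideanSpace ℝ (Fin n) → PathSpace m M} (hφ : IsPlot φ)
    (u a : EuclideanSpace ℝ (Fin n)) {t : ℝ} (ht : t ∈ Icc (0 : ℝ) 1) :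
    plotTangent φ (u, t) (a, 0) =
      mfderiv (𝓡 n) (𝓡 m) (plotEval φ hφ (projIcc 0 1 zero_le_one t)) u a := by
  have h1 : HasMFDerivWithinAt 𝓘(ℝ, EuclideanSpace ℝ (Fin n) × ℝ) (𝓡 m) (plotUncurry φ)
      (univ ×ˢ Icc 0 1) (u, t) (plotTangent φ (u, t)) :=
    ((contMDiffOn_plotUncurry hφ (u, t) ⟨mem_univ _, ht⟩).mdifferentiableWithinAt
      (by simp)).hasMFDerivWithinAt
  have h2 : HasMFDerivWithinAt (𝓡 n) 𝓘(ℝ, EuclideanSpace ℝ (Fin n) × ℝ)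
      (fun v : EuclideanSpace ℝ (Fin n) ↦ (v, t)) univ u
      (ContinuousLinearMap.inl ℝ (EuclideanSpace ℝ (Fin n)) ℝ) :=
    (hasFDerivAt_prodMk_left u t).hasMFDerivAt.hasMFDerivWithinAt
  have h3 := (HasMFDerivWithinAt.comp u h1 h2 fun v _ ↦ mk_mem_prod (mem_univ v) ht)
  exact (congrArg (fun T : EuclideanSpace ℝ (Fin n) →L[ℝ] EuclideanSpace ℝ (Fin m) ↦ T a)
    (hasMFDerivWithinAt_univ.1 h3).mfderiv).symm

theorem plotTangent_inr {φ : EuclideanSpace ℝ (Fin n) → PathSpace m M} (hφ : IsPlot φ)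
    (u : EuclideanSpace ℝ (Fin n)) {t : ℝ} (ht : t ∈ Icc (0 : ℝ) 1) :
    plotTangent φ (u, t) (0, 1) =
      mfderiv (𝓡∂ 1) (𝓡 m) (φ u) (projIcc 0 1 zero_le_one t) 1 := by
  have h1 : HasMFDerivWithinAt 𝓘(ℝ, EuclideanSpace ℝ (Fin n) × ℝ) (𝓡 m) (plotUncurry φ)
      (univ ×ˢ Icc 0 1) (u, t) (plotTangent φ (u, t)) :=
    ((contMDiffOn_plotUncurry hφ (u, t) ⟨mem_univ _, ht⟩).mdifferentiableWithinAt
      (by simp)).hasMFDerivWithinAt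
  have h2 : HasMFDerivWithinAt 𝓘(ℝ, ℝ) 𝓘(ℝ, EuclideanSpace ℝ (Fin n) × ℝ)
      (fun s : ℝ ↦ (u, s)) (Icc 0 1) t
      (ContinuousLinearMap.inr ℝ (EuclideanSpace ℝ (Fin n)) ℝ) :=
    (hasFDerivAt_prodMk_right u t).hasMFDerivAt.hasMFDerivWithinAt
  have h3 := (HasMFDerivWithinAt.comp t h1 h2 fun s hs ↦ mk_mem_prod (mem_univ u) hs)
  have h4 := h3.mfderivWithin (uniqueDiffOn_Icc zero_lt_one t ht).uniqueMDiffWithinAt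
  -- The unit tangent vector of the manifold with boundary [0, 1] corresponds to the ordinary
  -- derivative within [0, 1], so ∂_t is sent to the velocity of the path.
  have h5 := mfderivWithin_comp_projIcc_one (I := 𝓡 m) (f := φ u) (w := ⟨t, ht⟩)
  have h6 : (⟨t, ht⟩ : unitInterval) = projIcc 0 1 zero_le_one t :=
    (projIcc_of_mem zero_le_one ht).symm
  have h7 := congrArg (fun s : unitInterval ↦
    (mfderiv (𝓡∂ 1) (𝓡 m) (φ u) s 1 : EuclideanSpace ℝ (Fin m))) h6
  exact (congrArg (fun T : ℝ →L[ℝ] EuclideanSpace ℝ (Fin m) ↦ T 1) h4).symm.trans (h5.trans h7)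

theorem SymplecticForm.along_plotDeriv (symp : SymplecticForm m M)
    {φ : EuclideanSpace ℝ (Fin n) → PathSpace m M} (hφ : IsPlot φ)
    (u a b : EuclideanSpace ℝ (Fin n)) {t : ℝ} (ht : t ∈ Icc (0 : ℝ) 1) :
    symp.along (φ u) (plotDeriv φ hφ u a) (plotDeriv φ hφ u b) t =
      symp.onPlot φ (a, 0) (b, 0) (u, t) :=
  (congrArg₂ (fun x y ↦ symp.form (plotUncurry φ (u, t)) x y) (plotTangent_inl hφ u a ht)
    (plotTangent_inl hφ u b ht)).symm

theorem SymplecticForm.along_velocity (symp : SymplecticForm m M)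
    {φ : EuclideanSpace ℝ (Fin n) → PathSpace m M} (hφ : IsPlot φ)
    (u b : EuclideanSpace ℝ (Fin n)) {t : ℝ} (ht : t ∈ Icc (0 : ℝ) 1) :
    symp.along (φ u) (velocity (φ u)) (plotDeriv φ hφ u b) t =
      symp.onPlot φ (0, 1) (b, 0) (u, t) :=
  (congrArg₂ (fun x y ↦ symp.form (plotUncurry φ (u, t)) x y) (plotTangent_inr hφ u ht)
    (plotTangent_inl hφ u b ht)).symm

theorem pathSymplecticForm_plotDeriv (symp : SymplecticForm m M)
    {φ : EuclideanSpace ℝ (Fin n) → PathSpace m M} (hφ : IsPlot φ)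
    (u a b : EuclideanSpace ℝ (Fin n)) :
    pathSymplecticForm symp (φ u) (plotDeriv φ hφ u a) (plotDeriv φ hφ u b) =
      ∫ t in (0 : ℝ)..1, symp.onPlot φ (a, 0) (b, 0) (u, t) :=
  intervalIntegral.integral_congr fun t ht ↦
    symp.along_plotDeriv hφ u a b (by rwa [uIcc_of_le zero_le_one] at ht)

/-- The weight 1 - t measures how long the value at t contributes to the inner primitive. The
resulting single integral can be differentiated in the parameter. -/
theorem plotPullback_chenOneForm (symp : SymplecticForm m M)
    {φ : EuclideanSpace ℝ (Fin n) → PathSpace m M} (hφ : IsPlot φ)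
    (u b : EuclideanSpace ℝ (Fin n)) :
    plotPullback (chenOneForm symp) φ hφ u b =
      ∫ t in (0 : ℝ)..1, (1 - t) * symp.onPlot φ (0, 1) (b, 0) (u, t) := by
  refine (integral_integral_eq_integral_one_sub_mul (symp.continuous_along (φ u) (velocity (φ u))
    (plotDeriv φ hφ u b))).trans (intervalIntegral.integral_congr fun t ht ↦ ?_)
  exact congrArg _ (symp.along_velocity hφ u b (by rwa [uIcc_of_le zero_le_one] at ht))

theorem SymplecticForm.contDiffOn_one_sub_mul_onPlot (symp : SymplecticForm m M)
    {φ : EuclideanSpace ℝ (Fin n) → PathSpace m M} (hφ : IsPlot φ)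
    (v w : EuclideanSpace ℝ (Fin n) × ℝ) :
    ContDiffOn ℝ ∞ (fun p : EuclideanSpace ℝ (Fin n) × ℝ ↦ (1 - p.2) * symp.onPlot φ v w p)
      (univ ×ˢ Icc 0 1) :=
  (contDiff_const.sub contDiff_snd).contDiffOn.mul (symp.contDiffOn_onPlot hφ v w)

/-- Since ℝⁿ is finite-dimensional, smoothness may be tested on constant vectors, where it is
smoothness of a parametric integral. -/
theorem contDiff_plotPullback_chenOneForm (symp : SymplecticForm m M)
    {φ : EuclideanSpace ℝ (Fin n) → PathSpace m M} (hφ : IsPlot φ) :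
    ContDiff (E := EuclideanSpace ℝ (Fin n)) (F := EuclideanSpace ℝ (Fin n) →L[ℝ] ℝ) ℝ ∞
      (plotPullback (chenOneForm symp) φ hφ) := by
  refine contDiff_clm_apply_iff.2 fun b ↦ ?_
  exact (congrArg (fun g : EuclideanSpace ℝ (Fin n) → ℝ ↦ ContDiff ℝ ∞ g)
    (funext fun u ↦ plotPullback_chenOneForm symp hφ u b)).mpr
    (contDiff_integral_slice (symp.contDiffOn_one_sub_mul_onPlot hφ (0, 1) (b, 0)))

/-- At interior times the strip is a neighbourhood, so (u, t) ↦ φ(u)(t) is genuinely smooth there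
and closedness of its pull-back applies. -/
theorem SymplecticForm.fderivWithin_onPlot_cyclic (symp : SymplecticForm m M)
    {φ : EuclideanSpace ℝ (Fin n) → PathSpace m M} (hφ : IsPlot φ)
    (u : EuclideanSpace ℝ (Fin n)) {t : ℝ} (ht : t ∈ Ioo (0 : ℝ) 1)
    (a b c : EuclideanSpace ℝ (Fin n) × ℝ) :
    fderivWithin ℝ (symp.onPlot φ b c) (univ ×ˢ Icc 0 1) (u, t) a
      + fderivWithin ℝ (symp.onPlot φ c a) (univ ×ˢ Icc 0 1) (u, t) b
      + fderivWithin ℝ (symp.onPlot φ a b) (univ ×ˢ Icc 0 1) (u, t) c = 0 := by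
  have hS : (univ ×ˢ Icc 0 1 : Set (EuclideanSpace ℝ (Fin n) × ℝ)) ∈ 𝓝 (u, t) :=
    prod_mem_nhds Filter.univ_mem (Icc_mem_nhds ht.1 ht.2)
  have hΦ : ContMDiffAt 𝓘(ℝ, EuclideanSpace ℝ (Fin n) × ℝ) (𝓡 m) 2 (plotUncurry φ) (u, t) :=
    ((contMDiffOn_plotUncurry hφ).contMDiffAt hS).of_le ENat.LEInfty.out
  have e (v w : EuclideanSpace ℝ (Fin n) × ℝ) :
      fderivWithin ℝ (symp.onPlot φ v w) (univ ×ˢ Icc 0 1) (u, t) =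
      fderiv ℝ (fun q ↦ symp.form (plotUncurry φ q)
        (mfderiv 𝓘(ℝ, EuclideanSpace ℝ (Fin n) × ℝ) (𝓡 m) (plotUncurry φ) q v)
        (mfderiv 𝓘(ℝ, EuclideanSpace ℝ (Fin n) × ℝ) (𝓡 m) (plotUncurry φ) q w)) (u, t) := by
    rw [fderivWithin_of_mem_nhds hS]
    refine Filter.EventuallyEq.fderiv_eq ?_
    filter_upwards [eventually_mem_nhds_iff.2 hS] with q hq
    simp only [SymplecticForm.onPlot, plotTangent]
    rw [mfderivWithin_of_mem_nhds hq]
    rfl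
  rw [e, e, e]
  exact symp.fderiv_pullback_cyclic hΦ a b c

theorem fderivParam_one_sub_mul {U : Type*} [NormedAddCommGroup U] [NormedSpace ℝ U]
    {K : U × ℝ → ℝ} (hK : DifferentiableOn ℝ K (univ ×ˢ Icc 0 1)) (u : U) {t : ℝ}
    (ht : t ∈ Icc (0 : ℝ) 1) :
    fderivParam (fun p ↦ (1 - p.2) * K p) (u, t) = (1 - t) • fderivParam K (u, t) := by
  have hd : DifferentiableOn ℝ (fun p : U × ℝ ↦ (1 - p.2) * K p) (univ ×ˢ Icc 0 1) :=
    DifferentiableOn.mul (by fun_prop) hK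
  exact (hasFDerivAt_fderivParam hd u ht).unique
    ((hasFDerivAt_fderivParam hK u ht).const_mul (1 - t))

/-- The exterior derivative of the pull-back of `λ` along a plot. -/
theorem fderiv_plotPullback_chenOneForm (symp : SymplecticForm m M)
    {φ : EuclideanSpace ℝ (Fin n) → PathSpace m M} (hφ : IsPlot φ)
    (u a b : EuclideanSpace ℝ (Fin n)) :
    fderiv ℝ (fun v ↦ plotPullback (chenOneForm symp) φ hφ v b) u a
      - fderiv ℝ (fun v ↦ plotPullback (chenOneForm symp) φ hφ v a) u b =
    pathSymplecticForm symp (φ u) (plotDeriv φ hφ u a) (plotDeriv φ hφ u b)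
      - symp.form (φ u 0) (mfderiv (𝓡 n) (𝓡 m) (plotEval φ hφ 0) u a)
        (mfderiv (𝓡 n) (𝓡 m) (plotEval φ hφ 0) u b) := by
  have hQ := symp.contDiffOn_onPlot hφ
  have hK (v w) := (symp.contDiffOn_one_sub_mul_onPlot hφ v w).of_le (by simp : (1 : ℕ∞ω) ≤ ∞)
  have hd (v w) : DifferentiableOn ℝ (symp.onPlot φ v w) (univ ×ˢ Icc 0 1) :=
    (hQ v w).differentiableOn (by simp)
  have e (a b : EuclideanSpace ℝ (Fin n)) :
      fderiv ℝ (fun v ↦ plotPullback (chenOneForm symp) φ hφ v b) u a =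
        ∫ t in (0 : ℝ)..1, fderivParam (fun p : EuclideanSpace ℝ (Fin n) × ℝ ↦
          (1 - p.2) * symp.onPlot φ (0, 1) (b, 0) p) (u, t) a := by
    rw [funext fun v ↦ plotPullback_chenOneForm symp hφ v b]
    exact fderiv_integral_slice (hK (0, 1) (b, 0)) u a
  have hi (a b : EuclideanSpace ℝ (Fin n)) : IntervalIntegrable (fun t ↦
      fderivParam (fun p : EuclideanSpace ℝ (Fin n) × ℝ ↦
          (1 - p.2) * symp.onPlot φ (0, 1) (b, 0) p) (u, t) a) volume 0 1 :=
    intervalIntegrable_slice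
      (ContDiffOn.fderivParam_apply (k := 0) (hK _ _) (by simp) a).continuousOn u
  have hT : ContinuousOn (fun p ↦ fderivWithin ℝ (symp.onPlot φ (a, 0) (b, 0)) (univ ×ˢ Icc 0 1) p
      (0, 1)) (univ ×ˢ Icc 0 1) :=
    ((hQ _ _).continuousOn_fderivWithin uniqueDiffOn_univ_prod_Icc (by simp)).clm_apply
      continuousOn_const
  -- The t-derivative is moved onto the weight 1 - t. The boundary term at 1 vanishes, while the one
  -- at 0 produces -ev₀^*ω.
  have hparts := intervalIntegral.integral_mul_deriv_eq_deriv_mul_of_hasDerivAt (a := 0) (b := 1)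
    (u := fun t ↦ 1 - t) (u' := fun _ ↦ -1)
    (v := fun t ↦ symp.onPlot φ (a, 0) (b, 0) (u, t))
    (v' := fun t ↦ fderivWithin ℝ (symp.onPlot φ (a, 0) (b, 0)) (univ ×ˢ Icc 0 1) (u, t) (0, 1))
    (by fun_prop)
    (by rw [uIcc_of_le zero_le_one]; exact continuousOn_slice (hQ _ _).continuousOn u)
    (fun t _ ↦ by simpa using (hasDerivAt_id t).const_sub 1)
    (fun t ht ↦ by
      rw [min_eq_left zero_le_one, max_eq_right zero_le_one] at ht
      have hS : (univ ×ˢ Icc 0 1 : Set (EuclideanSpace ℝ (Fin n) × ℝ)) ∈ 𝓝 (u, t) :=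
        prod_mem_nhds Filter.univ_mem (Icc_mem_nhds ht.1 ht.2)
      rw [fderivWithin_of_mem_nhds hS]
      have h1 := ((hd (a, 0) (b, 0)).differentiableAt hS).hasFDerivAt
      have h2 : HasDerivAt (fun s : ℝ ↦ (u, s)) (0, 1) t :=
        (hasDerivAt_const t u).prodMk (hasDerivAt_id t)
      exact h1.comp_hasDerivAt t h2)
    intervalIntegrable_const (intervalIntegrable_slice hT u)
  rw [e, e, ← intervalIntegral.integral_sub (hi a b) (hi b a), pathSymplecticForm_plotDeriv]
  have h0 : symp.form (φ u 0) (mfderiv (𝓡 n) (𝓡 m) (plotEval φ hφ 0) u a)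
      (mfderiv (𝓡 n) (𝓡 m) (plotEval φ hφ 0) u b) = symp.onPlot φ (a, 0) (b, 0) (u, 0) := by
    rw [← symp.along_plotDeriv hφ u a b (left_mem_Icc.2 zero_le_one)]
    exact congrArg (fun s : unitInterval ↦ symp.form (φ u s)
      (mfderiv (𝓡 n) (𝓡 m) (plotEval φ hφ s) u a) (mfderiv (𝓡 n) (𝓡 m) (plotEval φ hφ s) u b))
      (projIcc_left (zero_le_one (α := ℝ))).symm
  rw [h0]
  have hcongr : ∫ t in (0 : ℝ)..1,
      (fderivParam (fun p : EuclideanSpace ℝ (Fin n) × ℝ ↦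
          (1 - p.2) * symp.onPlot φ (0, 1) (b, 0) p) (u, t) a
        - fderivParam (fun p : EuclideanSpace ℝ (Fin n) × ℝ ↦
          (1 - p.2) * symp.onPlot φ (0, 1) (a, 0) p) (u, t) b) =
      ∫ t in (0 : ℝ)..1, (1 - t) * fderivWithin ℝ (symp.onPlot φ (a, 0) (b, 0))
        (univ ×ˢ Icc 0 1) (u, t) (0, 1) := by
    -- The endpoints do not affect the integral, so closedness at interior times suffices.
    refine intervalIntegral.integral_congr_Ioo_of_le zero_le_one fun t ht ↦ ?_
    have ht' := Ioo_subset_Icc_self ht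
    simp only [fderivParam_one_sub_mul (hd _ _) u ht']
    -- Closedness for the triple (a, b, ∂_t), solved for the derivative in t of the pulled back form
    -- on (a, b).
    have hc := symp.fderivWithin_onPlot_cyclic hφ u ht (a, 0) (b, 0) (0, 1)
    have hanti : symp.onPlot φ (b, 0) (0, 1) = -symp.onPlot φ (0, 1) (b, 0) :=
      funext fun p ↦ symp.antisymm _ _ _
    rw [hanti, fderivWithin_neg (uniqueDiffOn_univ_prod_Icc (u, t) ⟨mem_univ _, ht'⟩)] at hc
    simp only [neg_apply] at hc
    simp only [fderivParam, smul_apply, ContinuousLinearMap.comp_apply,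
      ContinuousLinearMap.inl_apply, smul_eq_mul]
    linear_combination (-(1 - t)) * hc
  rw [hcongr, hparts]
  simp
  ring

end PlotForms

/-! ### Compatibility with smooth changes of parameters -/

section Reparametrization

variable {m : ℕ} {M : Type*} [TopologicalSpace M] [ChartedSpace (EuclideanSpace ℝ (Fin m)) M]
  [IsManifold (𝓡 m) ∞ M] {n k : ℕ}

theorem mfderiv_plotEval_comp {φ : EuclideanSpace ℝ (Fin n) → PathSpace m M} (hφ : IsPlot φ)
    {ψ : EuclideanSpace ℝ (Fin k) → EuclideanSpace ℝ (Fin n)} (hψ : ContDiff ℝ ∞ ψ)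
    (t : unitInterval) (u w : EuclideanSpace ℝ (Fin k)) :
    mfderiv (𝓡 k) (𝓡 m) (plotEval (φ ∘ ψ) (isPlot_reparam hφ hψ) t) u w =
      mfderiv (𝓡 n) (𝓡 m) (plotEval φ hφ t) (ψ u) (fderiv ℝ ψ u w) := by
  have h1 : MDifferentiableAt (𝓡 n) (𝓡 m) (plotEval φ hφ t) (ψ u) :=
    (plotEval φ hφ t).contMDiff.mdifferentiableAt (by simp)
  have h2 : MDifferentiableAt (𝓡 k) (𝓡 n) ψ u := hψ.contMDiff.mdifferentiableAt (by simp)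
  refine (mfderiv_comp_apply u h1 h2 w).trans ?_
  rw [mfderiv_eq_fderiv]
  rfl

theorem plotPullback_comp (α : ∀ γ : PathSpace m M, PathTangent γ →ₗ[ℝ] ℝ)
    {φ : EuclideanSpace ℝ (Fin n) → PathSpace m M} (hφ : IsPlot φ)
    {ψ : EuclideanSpace ℝ (Fin k) → EuclideanSpace ℝ (Fin n)} (hψ : ContDiff ℝ ∞ ψ)
    (u w : EuclideanSpace ℝ (Fin k)) :
    plotPullback α (φ ∘ ψ) (isPlot_reparam hφ hψ) u w =
      plotPullback α φ hφ (ψ u) (fderiv ℝ ψ u w) :=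
  congrArg (α (φ (ψ u))) (ContMDiffSection.ext fun t ↦ mfderiv_plotEval_comp hφ hψ t u w)

variable {L : M → Type*} [TopologicalSpace (TotalSpace ℂ L)]
  [∀ x, AddCommGroup (L x)] [∀ x, Module ℂ (L x)] [∀ x, TopologicalSpace (L x)]
  [∀ x, IsTopologicalAddGroup (L x)] [∀ x, ContinuousSMul ℂ (L x)]
  [FiberBundle ℂ L] [VectorBundle ℂ ℂ L] [ContMDiffVectorBundle ∞ ℂ L (𝓡 m)]

/-- At `u` for φ ∘ ψ and at `ψ u` for φ the defining formula uses the preferred frame at the same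
point of `M`. No change of frame occurs, and the chain rule in each ingredient is enough. -/
theorem EvZeroConnection.addOneForm_evZeroPullback_comp (cov : ConnectionMap (𝓡 m) L) (c : ℂ)
    (α : ∀ γ : PathSpace m M, PathTangent γ →ₗ[ℝ] ℝ)
    {φ : EuclideanSpace ℝ (Fin n) → PathSpace m M} (hφ : IsPlot φ)
    {ψ : EuclideanSpace ℝ (Fin k) → EuclideanSpace ℝ (Fin n)} (hψ : ContDiff ℝ ∞ ψ)
    {σ : Π v, (plotEval φ hφ 0 *ᵖ L) v} {u : EuclideanSpace ℝ (Fin k)}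
    (hσ : DifferentiableSectionAt (𝓡 n) σ (ψ u)) (w : EuclideanSpace ℝ (Fin k)) :
    (evZeroPullback cov).addOneForm c α (φ ∘ ψ) (isPlot_reparam hφ hψ) (fun v ↦ σ (ψ v)) u w =
      (evZeroPullback cov).addOneForm c α φ hφ σ (ψ u) (fderiv ℝ ψ u w) := by
  let f := plotEval φ hφ 0
  let x₀ : M := f (ψ u)
  let s : L x₀ := σ (ψ u)
  have hy : f (ψ u) ∈ frameDomain L x₀ := mem_baseSet_trivializationAt ℂ L x₀
  have hg := ((differentiableSectionAt_pullback_iff f hy σ).1 hσ).differentiableAt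
  have e0 {l : ℕ} (g : EuclideanSpace ℝ (Fin l) → ℂ) (y v : EuclideanSpace ℝ (Fin l)) :
      mvfderiv (𝓡 l) g y v = fderiv ℝ g y v :=
    congrArg (fun T : EuclideanSpace ℝ (Fin l) →L[ℝ] ℂ ↦ T v) mfderiv_eq_fderiv
  have e1 : mvfderiv (𝓡 k) (fun v ↦ lineCoord (V := L) (x := f (ψ v)) x₀ (σ (ψ v))) u w =
      mvfderiv (𝓡 n) (fun z ↦ lineCoord (V := L) (x := f z) x₀ (σ z)) (ψ u) (fderiv ℝ ψ u w) :=
    (e0 _ _ _).trans ((congrArg (fun T : EuclideanSpace ℝ (Fin k) →L[ℝ] ℂ ↦ T w)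
      (fderiv_comp u hg (hψ.differentiable (by simp) u))).trans (e0 _ _ _).symm)
  have e2 := mfderiv_plotEval_comp hφ hψ 0 u w
  have e3 := plotPullback_comp α hφ hψ u w
  -- The value of the connection depends on the plot only through the derivative of the coordinate,
  -- the image tangent vector in `M`, and the value of the 1-form.
  let D (z : ℂ) (X : EuclideanSpace ℝ (Fin m)) (r : ℝ) : L x₀ :=
    z • lineFrame L x₀ x₀ + lineCoord x₀ s • cov (lineFrame L x₀) x₀ X + r • c • s
  exact (congrArg₂ (fun z X ↦ D z X _) e1 e2).trans (congrArg (D _ _) e3)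

end Reparametrization

/-! ### The curvature of ev₀^*∇ - √-1 ħ⁻¹ λ -/

section Prequantization

variable {m : ℕ} {M : Type*} [TopologicalSpace M] [T2Space M]
  [ChartedSpace (EuclideanSpace ℝ (Fin m)) M] [IsManifold (𝓡 m) ∞ M]
  {L : M → Type*} [TopologicalSpace (TotalSpace ℂ L)]
  [∀ x, AddCommGroup (L x)] [∀ x, Module ℂ (L x)] [∀ x, TopologicalSpace (L x)]
  [∀ x, IsTopologicalAddGroup (L x)] [∀ x, ContinuousSMul ℂ (L x)]
  [FiberBundle ℂ L] [VectorBundle ℂ ℂ L] [ContMDiffVectorBundle ∞ ℂ L (𝓡 m)]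

/-- The exterior derivative of the connection form of `ev₀^*∇ - √-1 r λ` along a plot. -/
theorem IsHermitianConnection.fderiv_pullbackForm_chenOneForm {H : HermitianMetric (𝓡 m) L}
    {cov : ConnectionMap (𝓡 m) L} (h : IsHermitianConnection H cov) (symp : SymplecticForm m M)
    {r : ℝ} (hcurv : HasCurvature cov fun x v w ↦ r * symp.form x v w) {n : ℕ}
    {φ : EuclideanSpace ℝ (Fin n) → PathSpace m M} (hφ : IsPlot φ)
    (u a b : EuclideanSpace ℝ (Fin n)) :
    let β : EuclideanSpace ℝ (Fin n) → EuclideanSpace ℝ (Fin n) →L[ℝ] ℂ := fun z ↦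
      pullbackForm cov (plotEval φ hφ 0) (-(Complex.I * r)) (plotPullback (chenOneForm symp) φ hφ)
        (plotEval φ hφ 0 u) z
    fderiv ℝ (fun z ↦ β z b) u a - fderiv ℝ (fun z ↦ β z a) u b =
      -(Complex.I * ((r • pathSymplecticForm symp (φ u)) (plotDeriv φ hφ u a)
        (plotDeriv φ hφ u b) : ℝ)) := by
  intro β
  set f := plotEval φ hφ 0
  set α : EuclideanSpace ℝ (Fin n) → EuclideanSpace ℝ (Fin n) →L[ℝ] ℝ :=
    plotPullback (chenOneForm symp) φ hφ
  have hαd : ContDiff ℝ ∞ α := contDiff_plotPullback_chenOneForm symp hφ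
  have hf2 : ContMDiffAt (𝓡 n) (𝓡 m) 2 f u := f.contMDiff.contMDiffAt.of_le ENat.LEInfty.out
  have hβ : ContDiffAt ℝ ∞ β u := contDiffAt_pullbackForm h f _ hαd u
  have hβd (b) : DifferentiableAt ℝ (fun z ↦ β z b) u :=
    (hβ.differentiableAt (by simp)).clm_apply (differentiableAt_const b)
  have hαb (b) : DifferentiableAt ℝ (fun z ↦ (α z b : ℂ) * (-(Complex.I * r))) u := by
    have : DifferentiableAt ℝ (fun z ↦ α z b) u :=
      (hαd.differentiable (by simp) u).clm_apply (differentiableAt_const b)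
    exact (Complex.ofRealCLM.differentiableAt.comp u this).mul_const _
  have hfd (a b : EuclideanSpace ℝ (Fin n)) :
      fderiv ℝ (fun z ↦ (α z b : ℂ) * (-(Complex.I * r))) u a =
        (fderiv ℝ (fun z ↦ α z b) u a : ℝ) * (-(Complex.I * r)) := by
    have h1 : HasFDerivAt (fun z ↦ α z b) _ u :=
      ((hαd.differentiable (by simp) u).clm_apply (differentiableAt_const b)).hasFDerivAt
    have h2 := (Complex.ofRealCLM.hasFDerivAt.comp u h1).mul_const (-(Complex.I * (r : ℂ)))
    have h3 := congrArg (fun T : EuclideanSpace ℝ (Fin n) →L[ℝ] ℂ ↦ T a) h2.fderiv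
    refine h3.trans ?_
    simp [mul_comm]
  have key (a b : EuclideanSpace ℝ (Fin n)) : fderiv ℝ (fun z ↦ β z b) u a =
      fderiv ℝ (fun q ↦ connectionForm cov (f u) (f q) (mfderiv (𝓡 n) (𝓡 m) f q b)) u a +
        (fderiv ℝ (fun z ↦ α z b) u a : ℝ) * (-(Complex.I * r)) := by
    have e : (fun q ↦ connectionForm cov (f u) (f q) (mfderiv (𝓡 n) (𝓡 m) f q b)) =
        fun z ↦ β z b - (α z b : ℂ) * (-(Complex.I * r)) :=
      funext fun z ↦ eq_sub_of_add_eq (pullbackForm_apply cov f _ α (f u) z b).symm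
    rw [e, fderiv_fun_sub (hβd b) (hαb b), sub_apply, hfd, sub_add_cancel]
  have h1 := h.fderiv_pullback_connectionForm hcurv hf2 a b
  have h2 := fderiv_plotPullback_chenOneForm symp hφ u a b
  -- Here `Y` stands for ev₀^*ω and `X` for ω̃: the connection form contributes -√-1 r Y and the
  -- added term -√-1 r (X - Y), so the evaluation form cancels.
  have aux (A B : ℂ) (p q X Y : ℝ) (hA : A - B = -(Complex.I * ((r * Y : ℝ) : ℂ)))
      (hp : p - q = X - Y) : A + p * (-(Complex.I * r)) - (B + q * (-(Complex.I * r))) =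
        -(Complex.I * ((r * X : ℝ) : ℂ)) := by
    have hp' := congrArg (fun x : ℝ ↦ (x : ℂ)) hp
    push_cast at hA hp' ⊢
    linear_combination hA - Complex.I * r * hp'
  rw [key, key]
  exact aux _ _ _ _ _ _ h1 h2

end Prequantization

end

theorem proposition4p2 {m : ℕ} {M : Type*} [TopologicalSpace M] [T2Space M]
    [SecondCountableTopology M] [ChartedSpace (EuclideanSpace ℝ (Fin m)) M]
    [IsManifold (𝓡 m) ∞ M] (symp : SymplecticForm m M)
    {L : M → Type*} [TopologicalSpace (TotalSpace ℂ L)]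
    [∀ x, AddCommGroup (L x)] [∀ x, Module ℂ (L x)] [∀ x, TopologicalSpace (L x)]
    [∀ x, IsTopologicalAddGroup (L x)] [∀ x, ContinuousSMul ℂ (L x)]
    [FiberBundle ℂ L] [VectorBundle ℂ ℂ L] [ContMDiffVectorBundle ∞ ℂ L (𝓡 m)]
    (H : HermitianMetric (𝓡 m) L)
    (nabla : ConnectionMap (𝓡 m) L) (hnabla : IsHermitianConnection H nabla)
    (hbar : ℝ) (hbar_pos : 0 < hbar)
    (hcurv : HasCurvature nabla fun x v w ↦ hbar⁻¹ * symp.form x v w) :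
    ((evZeroPullback nabla).addOneForm (-(Complex.I * (hbar⁻¹ : ℝ))) (chenOneForm symp)).IsHermitian
        H ∧
      ((evZeroPullback nabla).addOneForm (-(Complex.I * (hbar⁻¹ : ℝ)))
        (chenOneForm symp)).HasCurvature fun γ ↦ hbar⁻¹ • pathSymplecticForm symp γ := by
  refine ⟨⟨fun n φ hφ ↦ ?_, fun n k φ hφ ψ hψ σ u w hσ ↦ ?_⟩, fun n φ hφ ↦ ?_⟩
  -- The condition discharged by `simp` is that -√-1 ħ⁻¹ has zero real part.
  · exact hnabla.addOneForm_pullback (plotEval φ hφ 0) (by simp)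
      (contDiff_plotPullback_chenOneForm symp hφ)
  · exact EvZeroConnection.addOneForm_evZeroPullback_comp nabla _ _ hφ hψ hσ w
  · exact hnabla.hasCurvature_addOneForm_pullback (plotEval φ hφ 0) _
      (contDiff_plotPullback_chenOneForm symp hφ)
      (hnabla.fderiv_pullbackForm_chenOneForm symp hcurv hφ)
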